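/- In the deterministic $\mathsf{VOLUME}$ model, the input is a graph on $n$ nodes; the nodes have distinct identifiers from $\{1,\dots,n^k\}$ for a constant $k$, and every node numbers its incident edges by ports. To answer the query of a node $v$, a deterministic algorithm, which knows $n$ (and the constants $c,\Delta,k$), starts with the identifier and the degree of $v$ and makes adaptive probes: it names a node that it has already discovered and one of the ports of that node, and learns the identifier and the degree of the node at the other end of that edge, and the port number which the edge has there. Finally it outputs the color of $v$. Computation is free; the complexity of an algorithm on $n$-node inputs is the maximum number of probes over all admissible $n$-node inputs and all queried nodes. The algorithm $c$-colors a class of inputs if on each of them the colors that it outputs at the individual queries form together a proper coloring with $c$ colors. **Theorem.** For every fixed $c\ge 2$, the deterministic $\mathsf{VOLUME}$ complexity of $c$-coloring bounded-degree trees is $\Theta(n)$. Precisely: 1. (Upper bound) For all constants $\Delta$ and $k$ there are a constant $C$ and a deterministic $\mathsf{VOLUME}$ algorithm that, for every $n$, $c$-colors all $n$-node trees of maximum degree at most $\Delta$ with identifiers from $\{1,\dots,n^k\}$ using at most $C\,n$ probes per query. 2. (Lower bound) There is a $\Delta_0$, depending only on $c$, such that for all constants $\Delta\ge\Delta_0$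 and $k\ge 10$ there are $\varepsilon>0$ and $n_0$ such that for every $n\ge n_0$, every deterministic $\mathsf{VOLUME}$ algorithm that $c$-colors all $n$-node trees of maximum degree at most $\Delta$ with identifiers from $\{1,\dots,n^k\}$ needs at least $\varepsilon n$ probes for some query on some such tree. -/

import Mathlib

namespace Volume

/-- A locally finite simple graph in which every vertex carries an identifier and a numbering of its
incident edges by the ports `0, …, deg v - 1` (so `deg v` is forced to be the degree of `v`).
Uniqueness of the identifiers is not part of the structure; see `IsTreeInput`. -/
structure Network (V : Type*) where
  graph : SimpleGraph V
  ident : V → ℕ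
  deg : V → ℕ
  port : (v : V) → Fin (deg v) ≃ graph.neighborSet v

/-- A deterministic probing strategy, as a decision tree. It either stops with an output, or probes
port `p` of the vertex with identifier `i` and continues depending on the answer, which consists of
three numbers: the identifier of the vertex `w` at the other end of that edge, the degree of `w`,
and the port that the edge has at `w`. -/
inductive Strategy (α : Type) : Type
  | output (a : α) : Strategy α
  | probe (i : ℕ) (p : ℕ) (next : ℕ → ℕ → ℕ → Strategy α) : Strategy α

/-- A deterministic `VOLUME` algorithm: given the number `n` of vertices of the input graph, and the
identifier and the degree of the queried vertex, it starts a probing strategy. Local computation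
is unbounded. -/
def Algorithm (α : Type) : Type := ℕ → ℕ → ℕ → Strategy α

namespace Network

variable {V : Type*} {α : Type}

/-- The neighbour of `u` that is reached through port `p`. -/
def neighbor (N : Network V) (u : V) (p : Fin (N.deg u)) : V := (N.port u p).1

/-- The port of the edge behind port `p` of `u` at its other endpoint. -/
def backPort (N : Network V) (u : V) (p : Fin (N.deg u)) : Fin (N.deg (N.neighbor u p)) :=
  (N.port (N.neighbor u p)).symm ⟨u, (N.port u p).2.symm⟩

/-- `N.Run S s t a`: when exactly the vertices of `S` have been discovered so far, the strategy `s`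
makes `t` further probes on `N` and then outputs `a`. A probe has to go through an existing port of
a vertex discovered before (no far probes), so the probed region is connected; a strategy that
attempts anything else has no run. -/
inductive Run (N : Network V) : Set V → Strategy α → ℕ → α → Prop
  | output (S : Set V) (a : α) : Run N S (Strategy.output a) 0 a
  | probe (S : Set V) (u : V) (hu : u ∈ S) (p : Fin (N.deg u))
      (next : ℕ → ℕ → ℕ → Strategy α) (t : ℕ) (a : α)
      (h : Run N (insert (N.neighbor u p) S)
        (next (N.ident (N.neighbor u p)) (N.deg (N.neighbor u p)) (N.backPort u p)) t a) :
      Run N S (Strategy.probe (N.ident u) p next) (t + 1) a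

/-- On the `n`-vertex network `N`, the query of `v` is answered by `A` with `a` after `t` probes. -/
def Answers {n : ℕ} (N : Network (Fin n)) (A : Algorithm α) (v : Fin n) (t : ℕ) (a : α) : Prop :=
  N.Run {v} (A n (N.ident v) (N.deg v)) t a

/-- `N` is an admissible `n`-vertex input: a tree of maximum degree at most `Δ` with unique
identifiers from `{1, …, n ^ k}`. -/
structure IsTreeInput {n : ℕ} (N : Network (Fin n)) (Δ k : ℕ) : Prop where
  isTree : N.graph.IsTree
  deg_le : ∀ v, N.deg v ≤ Δ
  ident_injective : Function.Injective N.ident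
  ident_mem : ∀ v, N.ident v ∈ Set.Icc 1 (n ^ k)

end Network

/-- `A` computes a proper `c`-coloring of every `n`-vertex tree of maximum degree at most `Δ` with
unique identifiers from `{1, …, n ^ k}`, whatever the identifiers and the port numbers are, and
answers every query with at most `q` probes. -/
def ColorsTrees (c Δ k n q : ℕ) (A : Algorithm (Fin c)) : Prop :=
  ∀ N : Network (Fin n), N.IsTreeInput Δ k →
    ∃ col : N.graph.Coloring (Fin c), ∀ v, ∃ t ≤ q, N.Answers A v t (col v)

end Volume

/-!
The upper bound is exhaustive exploration: probing every port of every discovered vertex costs at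
most `Δ * n` probes and reveals the same set of edges to all queries, so that a coloring chosen as a
function of this set is consistent (`exists_run_explore`, `exists_linear_algorithm`).

For the lower bound, the algorithm is run on an infinite tree, the Cayley graph of a free group of
rank `d = (5 * c) ^ 2`, whose vertices carry independent uniform labels of `m` bits as identifiers,
with `2 ^ m` about `n ^ 10`. The edge from `g` along the letter `a` has the port number of `a` at
`g`, so that the answer at the vertex `g` is the answer at `1` for the labelling translated by `g`.
Let `f` be the answer at `1`, a function of finitely many labels.

* A query meets few vertices, though possibly in a region of exponential size. Each newly discovered
  vertex has a fresh label, so the identifiers met by the queries of two neighbors are distinct up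
  to probability `(2 * q + 2) ^ 2 / 2 ^ m` (`avg_collision_le`).
* If they are distinct, and `q` is a small fraction of `n`, then the explored part of the
  infinite tree together with its neighbors has at most `n` vertices and extends to a tree on
  exactly `n` vertices with distinct identifiers. The algorithm behaves on that tree as on the
  infinite one, so it colors the two neighbors differently (`exists_eval_simulateAt_ne`).
* Hence `f` would be an approximate proper coloring of the shift action on labellings. This is
  impossible for few colors by a spectral bound as in Hoffman's inequality
  (`exists_lt_avg_of_shift_coloring`): the sum of the `2 * d` translations by letters has norm at
  most `4 * √d` on functions of mean zero. In the Walsh basis, the translations permute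
  the finite nonempty sets of bits, and of the `2 * d` translates of such a set at most two are
  not longer, when sets are measured by total word length. This orients the graph of translations
  with out-degrees at most two, and the norm bound is the Schur test (`sum_shift_le`,
  `sum_avg_mul_shift_ge`).
-/

namespace Volume

open scoped BigOperators

/-! ### Upper bound: exploring the whole tree -/

namespace Network

open Classical in
/-- The directed edges of `N`, named by the identifiers of their endpoints. -/
noncomputable def edgeIdents {n : ℕ} (N : Network (Fin n)) : Finset (ℕ × ℕ) :=
  (Finset.univ.filter fun e : Fin n × Fin n => N.graph.Adj e.1 e.2).image
    fun e => (N.ident e.1, N.ident e.2)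

lemma mem_edgeIdents {n : ℕ} {N : Network (Fin n)} {e : ℕ × ℕ} :
    e ∈ N.edgeIdents ↔ ∃ u w, N.graph.Adj u w ∧ (N.ident u, N.ident w) = e := by
  simp [edgeIdents]

lemma adj_neighbor {V : Type*} (N : Network V) (u : V) (p : Fin (N.deg u)) :
    N.graph.Adj u (N.neighbor u p) :=
  (N.port u p).2

lemma exists_neighbor_eq {V : Type*} (N : Network V) {u w : V} (h : N.graph.Adj u w) :
    ∃ p, N.neighbor u p = w :=
  ⟨(N.port u).symm ⟨w, h⟩, by simp [neighbor]⟩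

end Network

/-- Exhaustive exploration. The list `todo` holds the pairs (identifier, port) still to be probed,
`K` the identifiers seen so far and `E` the edges seen so far; at the end `out E` is output.
The first argument is a bound on the number of probes. -/
def explore {α : Type} (out : Finset (ℕ × ℕ) → α) :
    ℕ → List (ℕ × ℕ) → Finset ℕ → Finset (ℕ × ℕ) → Strategy α
  | _, [], _, E => .output (out E)
  | 0, _ :: _, _, E => .output (out E)
  | q + 1, e :: todo, K, E => .probe e.1 e.2 fun j d _ =>
      explore out q (if j ∈ K then todo else (List.range d).map (Prod.mk j) ++ todo)
        (insert j K) (insert (e.1, j) E)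

/-- The exploration ends with the set of all edges. The quantity
`todo.length + ∑ v ∉ S, deg v`, the number of (vertex, port) pairs not probed yet, drops by one
with every probe. -/
lemma exists_run_explore {α : Type} (out : Finset (ℕ × ℕ) → α) {n : ℕ} (N : Network (Fin n))
    (hinj : Function.Injective N.ident) (hconn : N.graph.Connected) (q : ℕ) :
    ∀ (todo : List (ℕ × ℕ)) (S : Finset (Fin n)) (E : Finset (ℕ × ℕ)),
      S.Nonempty →
      (∀ e ∈ todo, ∃ u ∈ S, N.ident u = e.1 ∧ e.2 < N.deg u) →
      (∀ u ∈ S, ∀ p : Fin (N.deg u), (N.ident u, (p : ℕ)) ∈ todo ∨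
        (N.ident u, N.ident (N.neighbor u p)) ∈ E ∧ N.neighbor u p ∈ S) →
      E ⊆ N.edgeIdents →
      todo.length + ∑ v ∈ Sᶜ, N.deg v ≤ q →
      ∃ t ≤ q, N.Run S (explore out q todo (S.image N.ident) E) t (out N.edgeIdents) := by
  induction q with
  | zero =>
    intro todo S E hne h1 h2 h3 hq
    have : todo = [] := List.length_eq_zero_iff.1 (by omega)
    subst this
    refine ⟨0, le_rfl, ?_⟩
    have hE := edges_eq S E hne h2 h3
    rw [explore, hE]
    exact .output _ _
  | succ q ih =>
    intro todo S E hne h1 h2 h3 hq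
    match todo with
    | [] =>
      refine ⟨0, Nat.zero_le _, ?_⟩
      have hE := edges_eq S E hne h2 h3
      rw [explore, hE]
      exact .output _ _
    | e :: todo =>
      obtain ⟨u, hu, hue, hp⟩ := h1 e (by simp)
      obtain ⟨i, p⟩ := e
      simp only at hue hp
      subst hue
      set w := N.neighbor u ⟨p, hp⟩ with hw
      have hadj : N.graph.Adj u w := N.adj_neighbor u ⟨p, hp⟩
      have hmem : N.ident w ∈ S.image N.ident ↔ w ∈ S := by
        simp [hinj.eq_iff]
      have hstep := ih
        (if N.ident w ∈ S.image N.ident then todo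
          else (List.range (N.deg w)).map (Prod.mk (N.ident w)) ++ todo)
        (insert w S) (insert (N.ident u, N.ident w) E) (by simp)
      have key := hstep ?_ ?_ ?_ ?_
      · obtain ⟨t, ht, hrun⟩ := key
        refine ⟨t + 1, by omega, ?_⟩
        rw [explore]
        refine Network.Run.probe (S : Set (Fin n)) u hu ⟨p, hp⟩ _ t _ ?_
        rw [Finset.coe_insert, Finset.image_insert] at hrun
        exact hrun
      · intro e he
        split_ifs at he with hwS
        · obtain ⟨v, hv, hv'⟩ := h1 e (by simp [he])
          exact ⟨v, by simp [hv], hv'⟩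
        · rcases List.mem_append.1 he with he | he
          · obtain ⟨r, hr, rfl⟩ := List.mem_map.1 he
            exact ⟨w, by simp, rfl, by simpa using hr⟩
          · obtain ⟨v, hv, hv'⟩ := h1 e (by simp [he])
            exact ⟨v, by simp [hv], hv'⟩
      · intro v hv r
        by_cases hvS : v ∈ S
        · rcases h2 v hvS r with h | ⟨h, h'⟩
          · rcases List.mem_cons.1 h with h | h
            · right
              obtain ⟨h, h'⟩ := Prod.mk.inj h
              obtain rfl := hinj h
              obtain rfl : r = ⟨p, hp⟩ := Fin.ext h'
              exact ⟨Finset.mem_insert_self _ _, Finset.mem_insert_self _ _⟩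
            · left
              split_ifs
              · exact h
              · exact List.mem_append_right _ h
          · exact .inr ⟨Finset.mem_insert_of_mem h, Finset.mem_insert_of_mem h'⟩
        · obtain rfl : v = w := (Finset.mem_insert.1 hv).resolve_right hvS
          left
          rw [if_neg (by rwa [hmem])]
          exact List.mem_append_left _ (List.mem_map.2 ⟨r, by simp, rfl⟩)
      · exact Finset.insert_subset (Network.mem_edgeIdents.2 ⟨u, w, hadj, rfl⟩) h3
      · simp only [hmem]
        simp only [List.length_cons] at hq
        split_ifs with hwS
        · rw [Finset.insert_eq_of_mem hwS]; omega
        · rw [Finset.compl_insert]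
          have := Finset.add_sum_erase Sᶜ N.deg (Finset.mem_compl.2 hwS)
          simp only [List.length_append, List.length_map, List.length_range]
          omega
where
  /-- A nonempty set all of whose ports lead back into it is everything. -/
  edges_eq (S : Finset (Fin n)) (E : Finset (ℕ × ℕ)) (hne : S.Nonempty)
      (h2 : ∀ u ∈ S, ∀ p : Fin (N.deg u), (N.ident u, (p : ℕ)) ∈ ([] : List (ℕ × ℕ)) ∨
        (N.ident u, N.ident (N.neighbor u p)) ∈ E ∧ N.neighbor u p ∈ S)
      (h3 : E ⊆ N.edgeIdents) : E = N.edgeIdents := by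
    simp only [List.not_mem_nil, false_or] at h2
    obtain ⟨u₀, hu₀⟩ := hne
    have hall : ∀ v, v ∈ S := by
      intro v
      obtain ⟨walk⟩ := hconn.preconnected u₀ v
      induction walk with
      | nil => exact hu₀
      | cons h _ ih =>
        obtain ⟨p, rfl⟩ := N.exists_neighbor_eq h
        exact ih (h2 _ hu₀ p).2
    refine h3.antisymm fun e he => ?_
    obtain ⟨u, w, h, rfl⟩ := Network.mem_edgeIdents.1 he
    obtain ⟨p, rfl⟩ := N.exists_neighbor_eq h
    exact (h2 u (hall u) p).1

/-- The graph on identifiers spanned by a set of edges. -/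
def identGraph (E : Finset (ℕ × ℕ)) : SimpleGraph ℕ :=
  SimpleGraph.fromRel fun i j => (i, j) ∈ E

lemma colorable_identGraph {c : ℕ} (hc : 2 ≤ c) {n : ℕ} (N : Network (Fin n))
    (hinj : Function.Injective N.ident) (htree : N.graph.IsTree) :
    (identGraph N.edgeIdents).Colorable c := by
  obtain ⟨col⟩ := htree.colorable_two.mono hc
  have : Nonempty (Fin n) := htree.connected.nonempty
  have key : ∀ i j, (i, j) ∈ N.edgeIdents →
      col (Function.invFun N.ident i) ≠ col (Function.invFun N.ident j) := by
    intro i j hij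
    obtain ⟨u, w, h, he⟩ := Network.mem_edgeIdents.1 hij
    obtain ⟨rfl, rfl⟩ := Prod.mk.inj he
    simpa only [Function.leftInverse_invFun hinj _] using col.valid h
  refine ⟨SimpleGraph.Coloring.mk (fun i => col (Function.invFun N.ident i)) ?_⟩
  intro i j hij
  rcases (SimpleGraph.fromRel_adj _ _ _).1 hij with ⟨-, h | h⟩
  · exact key _ _ h
  · exact (key _ _ h).symm

open Classical in
/-- The exploring algorithm is correct: all queries see the same set of edges, so that a coloring
chosen as a function of that set is consistent. -/
theorem exists_linear_algorithm {c : ℕ} (hc : 2 ≤ c) (Δ k : ℕ) :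
    ∃ (C : ℕ) (A : Algorithm (Fin c)), ∀ n : ℕ, ColorsTrees c Δ k n (C * n) A := by
  let out : ℕ → Finset (ℕ × ℕ) → Fin c := fun i E =>
    if h : (identGraph E).Colorable c then h.some i else ⟨0, by omega⟩
  refine ⟨Δ, fun n i d => explore (out i) (Δ * n) ((List.range d).map (Prod.mk i)) {i} ∅, ?_⟩
  intro n N hN
  have hcol := colorable_identGraph hc N hN.ident_injective hN.isTree
  refine ⟨SimpleGraph.Coloring.mk (fun v => out (N.ident v) N.edgeIdents) ?_, ?_⟩
  · intro u w h
    simp only [out, dif_pos hcol]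
    refine hcol.some.valid ((SimpleGraph.fromRel_adj _ _ _).2 ⟨?_, .inl ?_⟩)
    · exact hN.ident_injective.ne h.ne
    · exact Network.mem_edgeIdents.2 ⟨u, w, h, rfl⟩
  · intro v
    have := exists_run_explore (out (N.ident v)) N hN.ident_injective hN.isTree.connected (Δ * n)
      ((List.range (N.deg v)).map (Prod.mk (N.ident v))) {v} ∅ (by simp) (by simp) (by simp)
      (by simp) ?_
    · simp only [Finset.coe_singleton, Finset.image_singleton] at this
      exact this
    · have h1 := Finset.add_sum_erase Finset.univ N.deg (Finset.mem_univ v)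
      have h2 : ∑ w, N.deg w ≤ ∑ _w : Fin n, Δ := Finset.sum_le_sum fun w _ => hN.deg_le w
      simp only [Finset.sum_const, Finset.card_univ, Fintype.card_fin, smul_eq_mul] at h2
      rw [← Finset.compl_singleton] at h1
      rw [List.length_map, List.length_range, h1, mul_comm]
      exact h2

/-! ### Adaptive queries to independent labels -/

/-- A decision tree that adaptively queries the labels in `κ` of indices in `ι`. -/
inductive QueryTree (ι κ α : Type) : Type
  | leaf (a : α) : QueryTree ι κ α
  | query (i : ι) (next : κ → QueryTree ι κ α) : QueryTree ι κ α

namespace QueryTree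

variable {ι κ α β : Type}

/-- The output on the labelling `x`. -/
def eval : QueryTree ι κ α → (ι → κ) → α
  | leaf a, _ => a
  | query i next, x => (next (x i)).eval x

/-- `T.DepthLE t`: on every labelling, at most `t` queries are made. -/
def DepthLE : ℕ → QueryTree ι κ α → Prop
  | _, leaf _ => True
  | 0, query _ _ => False
  | t + 1, query _ next => ∀ k, DepthLE t (next k)

/-- Run one tree after the other, with the output of the second. -/
def andThen : QueryTree ι κ α → QueryTree ι κ β → QueryTree ι κ β
  | leaf _, T' => T'
  | query i next, T' => query i fun k => (next k).andThen T'

lemma DepthLE.mono : ∀ {t t' : ℕ} {T : QueryTree ι κ β}, T.DepthLE t → t ≤ t' → T.DepthLE t'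
  | _, 0, leaf _, _, _ => trivial
  | _, _ + 1, leaf _, _, _ => trivial
  | 0, _, query _ _, h, _ => h.elim
  | _ + 1, _ + 1, query _ _, h, htt' => fun k => DepthLE.mono (h k) (Nat.le_of_succ_le_succ htt')

lemma DepthLE.andThen {T' : QueryTree ι κ β} {t' : ℕ} (h' : T'.DepthLE t') :
    ∀ {t : ℕ} {T : QueryTree ι κ α}, T.DepthLE t → (T.andThen T').DepthLE (t' + t)
  | _, leaf _, _ => h'.mono (Nat.le_add_right _ _)
  | _ + 1, query _ _, h => fun k => DepthLE.andThen h' (h k)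

variable [DecidableEq ι]

/-- The set of indices queried on the labelling `x`. -/
def visited : QueryTree ι κ α → (ι → κ) → Finset ι
  | leaf _, _ => ∅
  | query i next, x => insert i ((next (x i)).visited x)

lemma visited_andThen (T' : QueryTree ι κ β) (x : ι → κ) :
    ∀ T : QueryTree ι κ α, (T.andThen T').visited x = T.visited x ∪ T'.visited x
  | leaf _ => by simp [andThen, visited]
  | query i next => by
    simp only [andThen, visited, visited_andThen T' x (next (x i)), Finset.insert_union]

lemma card_visited_le (x : ι → κ) :
    ∀ {t : ℕ} {T : QueryTree ι κ α}, T.DepthLE t → (T.visited x).card ≤ t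
  | _, leaf _, _ => by simp [visited]
  | _ + 1, query _ _, h =>
    (Finset.card_insert_le _ _).trans (Nat.succ_le_succ (card_visited_le x (h _)))

variable [Fintype κ]

/-- All indices that are queried on some labelling. -/
def support : QueryTree ι κ α → Finset ι
  | leaf _ => ∅
  | query i next => insert i (Finset.univ.biUnion fun k => (next k).support)

lemma eval_congr {x y : ι → κ} :
    ∀ (T : QueryTree ι κ α), (∀ i ∈ T.support, x i = y i) → T.eval x = T.eval y
  | leaf _, _ => rfl
  | query i next, h => by
    have hi : x i = y i := h i (Finset.mem_insert_self _ _)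
    rw [eval, eval, hi]
    refine eval_congr _ fun j hj => h j (Finset.mem_insert_of_mem ?_)
    exact Finset.mem_biUnion.2 ⟨_, Finset.mem_univ _, hj⟩

end QueryTree

section Average

variable {ι κ : Type} [DecidableEq ι] [Inhabited κ]

/-- Extend a labelling of the finite set `J` by a default label. -/
def extendLabel (J : Finset ι) (y : J → κ) (i : ι) : κ :=
  if h : i ∈ J then y ⟨i, h⟩ else default

lemma extendLabel_update {J : Finset ι} (y : J → κ) {i : ι} (hi : i ∈ J) (k : κ) :
    extendLabel J (Function.update y ⟨i, hi⟩ k) = Function.update (extendLabel J y) i k := by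
  ext j
  by_cases hj : j = i
  · subst hj; simp [extendLabel, hi]
  · by_cases hjJ : j ∈ J
    · simp [extendLabel, hjJ, hj]
    · simp [extendLabel, hjJ, hj]

variable [Fintype κ]

/-- The average of `F` over independent uniform labels on the finite set `J` (and the default label
elsewhere). -/
noncomputable def avg (J : Finset ι) (F : (ι → κ) → ℝ) : ℝ :=
  𝔼 y : J → κ, F (extendLabel J y)

lemma avg_mono {J : Finset ι} {F G : (ι → κ) → ℝ} (h : ∀ x, F x ≤ G x) : avg J F ≤ avg J G :=
  Finset.expect_le_expect fun _ _ => h _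

lemma avg_const (J : Finset ι) (a : ℝ) : avg J (fun _ : ι → κ => a) = a :=
  Fintype.expect_const a

lemma avg_add (J : Finset ι) (F G : (ι → κ) → ℝ) :
    avg J (fun x => F x + G x) = avg J F + avg J G :=
  Finset.expect_add_distrib _ _ _

lemma avg_sum {σ : Type} (J : Finset ι) (s : Finset σ) (F : σ → (ι → κ) → ℝ) :
    avg J (fun x => ∑ a ∈ s, F a x) = ∑ a ∈ s, avg J (F a) :=
  Finset.expect_sum_comm _ _ _

lemma avg_mul_left (J : Finset ι) (a : ℝ) (F : (ι → κ) → ℝ) :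
    avg J (fun x => a * F x) = a * avg J F :=
  (Finset.mul_expect _ _ _).symm

lemma avg_neg (J : Finset ι) (F : (ι → κ) → ℝ) : avg J (fun x => - F x) = - avg J F :=
  Finset.expect_neg_distrib _ _

/-- Applying a permutation to one label does not change the average. -/
lemma avg_update_equiv {J : Finset ι} {i : ι} (hi : i ∈ J) (σ : Equiv.Perm κ)
    (F : (ι → κ) → ℝ) : avg J (fun x => F (Function.update x i (σ (x i)))) = avg J F := by
  refine Fintype.expect_equiv
    (Equiv.piCongrRight fun j : J => if j = ⟨i, hi⟩ then σ else Equiv.refl κ) _ _ fun y => ?_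
  refine congrArg F ?_
  ext j
  by_cases hj : j = i
  · subst hj; simp [extendLabel, hi]
  · by_cases hjJ : j ∈ J
    · simp [extendLabel, hjJ, hj]
    · simp [extendLabel, hjJ, hj]

/-- Resampling one label does not change the average. -/
lemma avg_eq_expect_update {J : Finset ι} {i : ι} (hi : i ∈ J) (F : (ι → κ) → ℝ) :
    avg J F = 𝔼 k : κ, avg J fun x => F (Function.update x i k) := by
  have e : avg J F = 𝔼 p : (J → κ) × κ, F (extendLabel J p.1) := by
    rw [← Finset.univ_product_univ, Finset.expect_product]
    simp [avg]
  have e' : (𝔼 k : κ, avg J fun x => F (Function.update x i k)) =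
      𝔼 p : (J → κ) × κ, F (extendLabel J (Function.update p.1 ⟨i, hi⟩ p.2)) := by
    rw [← Finset.univ_product_univ, Finset.expect_product, Finset.expect_comm]
    simp only [avg, extendLabel_update]
  rw [e, e']
  let f : (J → κ) × κ → (J → κ) × κ := fun p => (Function.update p.1 ⟨i, hi⟩ p.2, p.1 ⟨i, hi⟩)
  have hf : Function.Involutive f := fun p => by simp [f]
  exact (Fintype.expect_equiv hf.toPerm _ _ fun p => rfl).symm

open Classical in
/-- Birthday bound for adaptive queries: if the labels on `R` are pairwise distinct already, then
`t` further queries find a repeated label with probability at most `t * (|R| + t) / |κ|`. -/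
lemma avg_collision_le {α : Type} {J : Finset ι} :
    ∀ (t : ℕ) (T : QueryTree ι κ α) (R : Finset ι) (r : ι → κ), T.DepthLE t → T.support ⊆ J →
      Set.InjOn r R →
      avg J (fun x => if Set.InjOn (R.piecewise r x) ↑(R ∪ T.visited (R.piecewise r x))
        then 0 else 1) ≤ t * (R.card + t) / Fintype.card κ := by
  intro t
  induction t with
  | zero =>
    intro T R r hT _ hr
    match T with
    | .leaf a =>
      have : ∀ x, Set.InjOn (R.piecewise r x) (R : Set ι) := fun x =>
        hr.congr fun i hi => by simp [Finset.mem_coe.1 hi]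
      simp [QueryTree.visited, this, avg_const]
    | .query i next => exact hT.elim
  | succ t ih =>
    intro T R r hT hJ hr
    match T with
    | .leaf a =>
      have : ∀ x, Set.InjOn (R.piecewise r x) (R : Set ι) := fun x =>
        hr.congr fun i hi => by simp [Finset.mem_coe.1 hi]
      simp only [QueryTree.visited, Finset.union_empty, this, if_true, avg_const]
      positivity
    | .query i next =>
      have hsub : ∀ k, (next k).support ⊆ J := fun k j hj =>
        hJ (Finset.mem_insert_of_mem (Finset.mem_biUnion.2 ⟨k, Finset.mem_univ _, hj⟩))
      have hκ : (0 : ℝ) < Fintype.card κ := by exact_mod_cast Fintype.card_pos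
      by_cases hi : i ∈ R
      · have h := ih (next (r i)) R r (hT _) (hsub _) hr
        have e : ∀ x, R ∪ QueryTree.visited (.query i next) (R.piecewise r x) =
            R ∪ (next (r i)).visited (R.piecewise r x) := fun x => by
          rw [QueryTree.visited, Finset.piecewise_eq_of_mem _ _ _ hi, Finset.union_insert,
            Finset.insert_eq_of_mem (Finset.mem_union_left _ hi)]
        simp only [e]
        refine h.trans ?_
        push_cast
        gcongr <;> linarith
      · have hiJ : i ∈ J := hJ (Finset.mem_insert_self _ _)
        rw [avg_eq_expect_update hiJ]
        have hpw : ∀ k x, R.piecewise r (Function.update x i k) =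
            (insert i R).piecewise (Function.update r i k) x := by
          intro k x
          ext j
          by_cases hj : j = i
          · subst hj; simp [hi]
          · by_cases hjR : j ∈ R <;> simp [hj, hjR]
        have e : ∀ k x, R ∪ QueryTree.visited (.query i next)
            ((insert i R).piecewise (Function.update r i k) x) =
            insert i R ∪ (next k).visited
              ((insert i R).piecewise (Function.update r i k) x) := fun k x => by
          rw [QueryTree.visited, Finset.piecewise_eq_of_mem _ _ _ (Finset.mem_insert_self _ _),
            Function.update_self, Finset.union_insert, Finset.insert_union]
        simp only [hpw, e]
        have step : ∀ k, avg J (fun x =>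
            if Set.InjOn ((insert i R).piecewise (Function.update r i k) x)
              ↑(insert i R ∪ (next k).visited
                ((insert i R).piecewise (Function.update r i k) x)) then (0 : ℝ) else 1) ≤
            (if k ∈ R.image r then 1 else 0) +
              t * ((R.card + 1 : ℕ) + t) / Fintype.card κ := by
          intro k
          split_ifs with hk
          · refine (avg_mono (G := fun _ => 1) fun x => ?_).trans ?_
            · split_ifs <;> norm_num
            · rw [avg_const]
              have : (0 : ℝ) ≤ t * ((R.card + 1 : ℕ) + t) / Fintype.card κ := by positivity
              linarith
          · rw [zero_add]
            have hr' : Set.InjOn (Function.update r i k) ↑(insert i R) := by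
              rw [Finset.coe_insert, Set.injOn_insert (by simpa using hi)]
              constructor
              · refine hr.congr fun j hj => ?_
                have : j ≠ i := fun h => hi (h ▸ hj)
                simp [this]
              · rintro ⟨j, hj, hjk⟩
                have : j ≠ i := fun h => hi (h ▸ hj)
                rw [Function.update_of_ne this, Function.update_self] at hjk
                exact hk (Finset.mem_image.2 ⟨j, hj, hjk⟩)
            have h := ih (next k) (insert i R) (Function.update r i k) (hT _) (hsub _) hr'
            rw [Finset.card_insert_of_notMem hi] at h
            exact h
        refine (Finset.expect_le_expect fun k _ => step k).trans ?_
        rw [Finset.expect_add_distrib, Fintype.expect_const]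
        have h1 : (𝔼 k : κ, if k ∈ R.image r then (1 : ℝ) else 0) ≤ R.card / Fintype.card κ := by
          rw [Fintype.expect_eq_sum_div_card, Finset.sum_boole, Finset.filter_mem_eq_inter,
            Finset.univ_inter]
          gcongr
          exact Finset.card_image_le
        refine (add_le_add_left h1 _).trans ?_
        rw [← add_div]
        push_cast
        gcongr
        nlinarith

end Average

/-! ### The Cayley tree of a free group -/

section FreeGroup

variable {α : Type} [DecidableEq α]

/-- The element of the free group given by a letter, that is, by a generator (`true`) or the inverse
of a generator (`false`). -/
def gen (a : α × Bool) : FreeGroup α := FreeGroup.mk [a]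

/-- The inverse letter. -/
def invLetter (a : α × Bool) : α × Bool := (a.1, !a.2)

omit [DecidableEq α] in
@[simp] lemma invLetter_invLetter (a : α × Bool) : invLetter (invLetter a) = a := by
  simp [invLetter]

omit [DecidableEq α] in
lemma gen_invLetter (a : α × Bool) : gen (invLetter a) = (gen a)⁻¹ := by
  simp [gen, invLetter, FreeGroup.inv_mk, FreeGroup.invRev]

omit [DecidableEq α] in
@[simp] lemma mul_gen_mul_gen_invLetter (g : FreeGroup α) (a : α × Bool) :
    g * gen a * gen (invLetter a) = g := by
  simp [gen_invLetter]

lemma toWord_gen_mul (a : α × Bool) (g : FreeGroup α) :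
    (∃ L, g.toWord = invLetter a :: L ∧ (gen a * g).toWord = L) ∨
      (g.toWord.head? ≠ some (invLetter a) ∧ (gen a * g).toWord = a :: g.toWord) := by
  have h : (gen a * g).toWord = FreeGroup.reduce (a :: g.toWord) := by
    conv_lhs => rw [← FreeGroup.mk_toWord (x := g)]
    rw [gen, FreeGroup.mul_mk, FreeGroup.toWord_mk]
    rfl
  rw [h, FreeGroup.reduce.cons, FreeGroup.reduce_toWord]
  rcases g.toWord with _ | ⟨b, L⟩
  · right; simp
  · by_cases hb : a.1 = b.1 ∧ a.2 = !b.2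
    · left
      refine ⟨L, ?_, by simp [hb]⟩
      congr 1
      exact Prod.ext hb.1.symm (by simp [invLetter, hb.2])
    · right
      refine ⟨?_, by simp [hb]⟩
      simp only [List.head?_cons, ne_eq, Option.some.injEq]
      rintro rfl
      exact hb ⟨rfl, by simp [invLetter]⟩

lemma norm_gen_mul_lt_iff (a : α × Bool) (g : FreeGroup α) :
    (gen a * g).norm < g.norm ↔ g.toWord.head? = some (invLetter a) := by
  rcases toWord_gen_mul a g with ⟨L, h1, h2⟩ | ⟨h1, h2⟩
  · simp [FreeGroup.norm, h1, h2]
  · simp [FreeGroup.norm, h1, h2]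

lemma norm_gen_mul (a : α × Bool) (g : FreeGroup α) :
    (gen a * g).norm + 1 = g.norm ∨ (gen a * g).norm = g.norm + 1 := by
  rcases toWord_gen_mul a g with ⟨L, h1, h2⟩ | ⟨h1, h2⟩
  · left; simp [FreeGroup.norm, h1, h2]
  · right; simp [FreeGroup.norm, h2]

/-- At most one letter shortens a given group element. -/
lemma eq_of_norm_gen_mul_lt {a b : α × Bool} {g : FreeGroup α} (ha : (gen a * g).norm < g.norm)
    (hb : (gen b * g).norm < g.norm) : a = b := by
  rw [norm_gen_mul_lt_iff] at ha hb
  have := Option.some.inj (ha.symm.trans hb)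
  rw [← invLetter_invLetter a, this, invLetter_invLetter]

lemma norm_mul_gen_eq (a : α × Bool) (g : FreeGroup α) :
    (g * gen a).norm = (gen (invLetter a) * g⁻¹).norm := by
  rw [← FreeGroup.norm_inv_eq, mul_inv_rev, gen_invLetter]

lemma norm_mul_gen (a : α × Bool) (g : FreeGroup α) :
    (g * gen a).norm + 1 = g.norm ∨ (g * gen a).norm = g.norm + 1 := by
  rw [norm_mul_gen_eq, ← FreeGroup.norm_inv_eq (x := g)]
  exact norm_gen_mul _ _

lemma eq_of_norm_mul_gen_lt {a b : α × Bool} {g : FreeGroup α} (ha : (g * gen a).norm < g.norm)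
    (hb : (g * gen b).norm < g.norm) : a = b := by
  rw [norm_mul_gen_eq, ← FreeGroup.norm_inv_eq (x := g)] at ha hb
  rw [← invLetter_invLetter a, eq_of_norm_gen_mul_lt ha hb, invLetter_invLetter]

lemma exists_norm_mul_gen_lt {g : FreeGroup α} (hg : g ≠ 1) :
    ∃ a, (g * gen a).norm < g.norm := by
  have h : g⁻¹.toWord ≠ [] := by rwa [ne_eq, FreeGroup.toWord_eq_nil_iff, inv_eq_one]
  obtain ⟨b, L, hL⟩ := List.exists_cons_of_ne_nil h
  refine ⟨b, ?_⟩
  rw [norm_mul_gen_eq, ← FreeGroup.norm_inv_eq (x := g), norm_gen_mul_lt_iff, hL]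
  simp

lemma gen_injective : Function.Injective (gen : α × Bool → FreeGroup α) := by
  intro a b h
  have h' := congrArg FreeGroup.toWord h
  simpa [gen] using h'

lemma mul_gen_ne (g : FreeGroup α) (a : α × Bool) : g * gen a ≠ g := fun h => by
  have := norm_mul_gen a g
  rw [h] at this
  omega

end FreeGroup

/-- The Cayley graph of the free group. -/
def cayley (α : Type) : SimpleGraph (FreeGroup α) where
  Adj g h := ∃ a, h = g * gen a
  symm := ⟨by
    rintro g h ⟨a, rfl⟩
    exact ⟨invLetter a, by simp⟩⟩
  loopless := ⟨by
    classical
    rintro g ⟨a, h⟩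
    exact mul_gen_ne g a h.symm⟩

/-- The Cayley graph of a free group has no cycles, since every vertex has at most one neighbor that
is not longer. -/
lemma cayley_isAcyclic (α : Type) : (cayley α).IsAcyclic := by
  classical
  intro v c hc
  -- A longest vertex of a cycle would have two different shorter neighbors.
  obtain ⟨u, hu, hmax⟩ := c.support.toFinset.exists_max_image FreeGroup.norm ⟨v, by simp⟩
  rw [List.mem_toFinset] at hu
  have hc' := hc.rotate hu
  have hshort : ∀ w ∈ (c.rotate u hu).support, (cayley α).Adj u w →
      ∃ a, w = u * gen a ∧ (u * gen a).norm < u.norm := by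
    rintro w hw ⟨a, rfl⟩
    refine ⟨a, rfl, ?_⟩
    have : (u * gen a).norm ≤ u.norm := hmax _ (by
      rw [List.mem_toFinset]
      exact (SimpleGraph.Walk.mem_support_rotate_iff _ _ hu).1 hw)
    have := norm_mul_gen a u
    omega
  obtain ⟨a, ha, ha'⟩ := hshort _ (SimpleGraph.Walk.getVert_mem_support _ 1)
    (SimpleGraph.Walk.adj_snd hc'.not_nil)
  obtain ⟨b, hb, hb'⟩ := hshort _ (SimpleGraph.Walk.getVert_mem_support _ _)
    (SimpleGraph.Walk.adj_penultimate hc'.not_nil).symm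
  exact hc'.snd_ne_penultimate (ha.trans ((eq_of_norm_mul_gen_lt ha' hb') ▸ hb.symm))

/-! ### Walsh expansions -/

/-- The character of `Bool`, as a sign. -/
def sgn (b : Bool) : ℝ := if b then -1 else 1

lemma sgn_mul_self (b : Bool) : sgn b * sgn b = 1 := by cases b <;> norm_num [sgn]

lemma sgn_not (b : Bool) : sgn (!b) = - sgn b := by cases b <;> simp [sgn]

/-- Every function of finitely many bits is a combination of products of signs. -/
lemma exists_sum_prod_sgn {I : Type} [DecidableEq I] (P : Finset I) :
    ∀ F : (I → Bool) → ℝ, (∀ x y, (∀ i ∈ P, x i = y i) → F x = F y) →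
      ∃ c : Finset I → ℝ, ∀ x, F x = ∑ S ∈ P.powerset, c S * ∏ i ∈ S, sgn (x i) := by
  induction P using Finset.induction_on with
  | empty =>
    intro F hF
    exact ⟨fun _ => F fun _ => false, fun x => by simpa using hF _ _ (by simp)⟩
  | insert i P hi ih =>
    intro F hF
    have hdep : ∀ b x y, (∀ j ∈ P, x j = y j) →
        F (Function.update x i b) = F (Function.update y i b) := by
      intro b x y h
      refine hF _ _ fun j hj => ?_
      by_cases hji : j = i
      · subst hji; simp
      · simp [hji, h j ((Finset.mem_insert.1 hj).resolve_left hji)]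
    obtain ⟨c₀, h₀⟩ := ih (fun x => F (Function.update x i false)) (hdep false)
    obtain ⟨c₁, h₁⟩ := ih (fun x => F (Function.update x i true)) (hdep true)
    refine ⟨fun S => if i ∈ S then (c₀ (S.erase i) - c₁ (S.erase i)) / 2
      else (c₀ S + c₁ S) / 2, fun x => ?_⟩
    have hF' : F x = (F (Function.update x i false) + F (Function.update x i true)) / 2 +
        sgn (x i) * ((F (Function.update x i false) - F (Function.update x i true)) / 2) := by
      have hx := Function.update_eq_self i x
      cases hb : x i <;> rw [hb] at hx <;> rw [hx] <;> simp [sgn] <;> ring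
    rw [hF', h₀, h₁, Finset.sum_powerset_insert hi, ← Finset.sum_add_distrib,
      ← Finset.sum_sub_distrib, Finset.sum_div, Finset.sum_div, Finset.mul_sum]
    congr 1
    · refine Finset.sum_congr rfl fun S hS => ?_
      have : i ∉ S := fun h => hi (Finset.mem_powerset.1 hS h)
      simp only [this, if_false]
      ring
    · refine Finset.sum_congr rfl fun S hS => ?_
      have : i ∉ S := fun h => hi (Finset.mem_powerset.1 hS h)
      simp only [Finset.mem_insert_self, if_true, Finset.erase_insert this,
        Finset.prod_insert this]
      ring

section Walsh

variable {ι : Type} [DecidableEq ι] {m : ℕ}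

/-- The Walsh function of a finite set of bits; the label of `i` consists of the bits `(i, j)`. -/
noncomputable def walsh (S : Finset (ι × Fin m)) (x : ι → Fin m → Bool) : ℝ :=
  ∏ i ∈ S, sgn (x i.1 i.2)

/-- All sets of bits of the labels of `J`. -/
def bitSets (m : ℕ) (J : Finset ι) : Finset (Finset (ι × Fin m)) :=
  (J ×ˢ Finset.univ).powerset

omit [DecidableEq ι] in
lemma mem_bitSets {J : Finset ι} {S : Finset (ι × Fin m)} :
    S ∈ bitSets m J ↔ ∀ i ∈ S, i.1 ∈ J := by
  simp [bitSets, Finset.subset_iff]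

lemma exists_walsh_expansion (J : Finset ι) (F : (ι → Fin m → Bool) → ℝ)
    (hF : ∀ x y, (∀ i ∈ J, x i = y i) → F x = F y) :
    ∃ c : Finset (ι × Fin m) → ℝ, ∀ x, F x = ∑ S ∈ bitSets m J, c S * walsh S x := by
  obtain ⟨c, hc⟩ := exists_sum_prod_sgn (J ×ˢ (Finset.univ : Finset (Fin m)))
    (fun x => F fun i j => x (i, j)) (fun x y h => hF _ _ fun i hi => funext fun j =>
      h (i, j) (by simp [hi]))
  exact ⟨c, fun x => hc fun i => x i.1 i.2⟩

/-- Walsh functions are orthonormal: for different sets, flipping a bit in which they differ changes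
the sign of the product. -/
lemma avg_walsh_mul_walsh {J : Finset ι} {S T : Finset (ι × Fin m)} (hS : S ∈ bitSets m J)
    (hT : T ∈ bitSets m J) :
    avg J (fun x => walsh S x * walsh T x) = if S = T then 1 else 0 := by
  have key : ∀ S T : Finset (ι × Fin m), S ∈ bitSets m J → ∀ i ∈ S, i ∉ T →
      avg J (fun x => walsh S x * walsh T x) = 0 := by
    intro S T hS i hi hiT
    have hiJ : i.1 ∈ J := mem_bitSets.1 hS i hi
    have hflip : Function.Involutive
        (fun k : Fin m → Bool => Function.update k i.2 (!k i.2)) := fun k => by simp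
    let σ : Equiv.Perm (Fin m → Bool) := hflip.toPerm _
    have h := avg_update_equiv hiJ σ (fun x => walsh S x * walsh T x)
    have hne : ∀ (x : ι → Fin m → Bool) (j : ι × Fin m), j ≠ i →
        Function.update x i.1 (Function.update (x i.1) i.2 (!x i.1 i.2)) j.1 j.2 = x j.1 j.2 := by
      intro x j hj
      by_cases h1 : j.1 = i.1
      · have h2 : j.2 ≠ i.2 := fun h2 => hj (Prod.ext h1 h2)
        rw [h1]; simp [h2]
      · simp [h1]
    have hneg : ∀ x : ι → Fin m → Bool,
        walsh S (Function.update x i.1 (σ (x i.1))) *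
          walsh T (Function.update x i.1 (σ (x i.1))) = - (walsh S x * walsh T x) := by
      intro x
      have e1 : walsh S (Function.update x i.1 (σ (x i.1))) = - walsh S x := by
        rw [walsh, walsh, ← Finset.mul_prod_erase _ _ hi, ← Finset.mul_prod_erase _ _ hi,
          ← neg_mul]
        congr 1
        · simp [σ, sgn_not]
        · exact Finset.prod_congr rfl fun j hj => by
            rw [← hne x j (Finset.ne_of_mem_erase hj)]; rfl
      have e2 : walsh T (Function.update x i.1 (σ (x i.1))) = walsh T x :=
        Finset.prod_congr rfl fun j hj => by
          rw [← hne x j (fun h => hiT (h ▸ hj))]; rfl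
      rw [e1, e2, neg_mul]
    simp only [hneg, avg_neg] at h
    linarith
  split_ifs with h
  · subst h
    have : ∀ x : ι → Fin m → Bool, walsh S x * walsh S x = 1 := fun x => by
      rw [walsh, ← Finset.prod_mul_distrib]
      exact Finset.prod_eq_one fun i _ => sgn_mul_self _
    simp only [this, avg_const]
  · by_cases hST : S ⊆ T
    · have hTS : ¬ T ⊆ S := fun hTS => h (hST.antisymm hTS)
      obtain ⟨i, hi, hi'⟩ := Finset.not_subset.1 hTS
      simp only [mul_comm (walsh S _)]
      exact key T S hT i hi hi'
    · obtain ⟨i, hi, hi'⟩ := Finset.not_subset.1 hST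
      exact key S T hS i hi hi'

/-- Parseval's identity. -/
lemma avg_sum_walsh_mul_sum_walsh {J : Finset ι} {σ τ : Type} (P : Finset σ) (Q : Finset τ)
    (a : σ → ℝ) (b : τ → ℝ) (S : σ → Finset (ι × Fin m)) (T : τ → Finset (ι × Fin m))
    (hS : ∀ s ∈ P, S s ∈ bitSets m J) (hT : ∀ t ∈ Q, T t ∈ bitSets m J) :
    avg J (fun x => (∑ s ∈ P, a s * walsh (S s) x) * ∑ t ∈ Q, b t * walsh (T t) x) =
      ∑ s ∈ P, ∑ t ∈ Q, if S s = T t then a s * b t else 0 := by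
  simp only [Finset.sum_mul_sum]
  rw [avg_sum]
  refine Finset.sum_congr rfl fun s hs => ?_
  rw [avg_sum]
  refine Finset.sum_congr rfl fun t ht => ?_
  have : ∀ x : ι → Fin m → Bool, a s * walsh (S s) x * (b t * walsh (T t) x) =
      a s * b t * (walsh (S s) x * walsh (T t) x) := fun x => by ring
  simp only [this, avg_mul_left, avg_walsh_mul_walsh (hS s hs) (hT t ht)]
  split_ifs <;> simp

end Walsh

/-! ### The spectral gap of the shift -/

/-- The Schur test, for a matrix with nonnegative entries, column sums at most `A` and row sums at
most `B`. -/
lemma sum_mul_le_of_schur {V : Type} (P : Finset V) (w : V → V → ℝ) (a : V → ℝ) {A B t : ℝ}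
    (ht : 0 < t) (hw : ∀ S T, 0 ≤ w S T) (hA : ∀ T ∈ P, ∑ S ∈ P, w S T ≤ A)
    (hB : ∀ S ∈ P, ∑ T ∈ P, w S T ≤ B) :
    ∑ S ∈ P, ∑ T ∈ P, w S T * (a S * a T) ≤ (t * A + B / t) / 2 * ∑ S ∈ P, a S ^ 2 := by
  have h1 : ∀ S T, w S T * (a S * a T) ≤
      w S T * (a T ^ 2 * (t / 2)) + w S T * (a S ^ 2 * (1 / t / 2)) := by
    intro S T
    rw [← mul_add]
    refine mul_le_mul_of_nonneg_left ?_ (hw S T)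
    have : a T ^ 2 * (t / 2) + a S ^ 2 * (1 / t / 2) - a S * a T =
        (t * a T - a S) ^ 2 / (2 * t) := by
      field_simp
      ring
    have : 0 ≤ (t * a T - a S) ^ 2 / (2 * t) := by positivity
    linarith
  calc ∑ S ∈ P, ∑ T ∈ P, w S T * (a S * a T)
      ≤ ∑ S ∈ P, ∑ T ∈ P, (w S T * (a T ^ 2 * (t / 2)) + w S T * (a S ^ 2 * (1 / t / 2))) :=
        Finset.sum_le_sum fun S _ => Finset.sum_le_sum fun T _ => h1 S T
    _ = ∑ T ∈ P, (∑ S ∈ P, w S T) * (a T ^ 2 * (t / 2)) +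
        ∑ S ∈ P, (∑ T ∈ P, w S T) * (a S ^ 2 * (1 / t / 2)) := by
        simp only [Finset.sum_add_distrib, Finset.sum_mul]
        rw [Finset.sum_comm]
    _ ≤ ∑ T ∈ P, A * (a T ^ 2 * (t / 2)) + ∑ S ∈ P, B * (a S ^ 2 * (1 / t / 2)) := by
        refine add_le_add (Finset.sum_le_sum fun T hT => ?_) (Finset.sum_le_sum fun S hS => ?_)
        · exact mul_le_mul_of_nonneg_right (hA T hT) (by positivity)
        · exact mul_le_mul_of_nonneg_right (hB S hS) (by positivity)
    _ = (t * A + B / t) / 2 * ∑ S ∈ P, a S ^ 2 := by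
        rw [← Finset.sum_add_distrib, Finset.mul_sum]
        refine Finset.sum_congr rfl fun S _ => ?_
        ring

section Shift

variable {α : Type} [DecidableEq α] {m : ℕ}

/-- Left translation of a set of bits. -/
def shift (g : FreeGroup α) (S : Finset (FreeGroup α × Fin m)) : Finset (FreeGroup α × Fin m) :=
  S.map ⟨fun i => (g * i.1, i.2), fun i j h => by
    obtain ⟨h1, h2⟩ := Prod.mk.inj h
    exact Prod.ext (mul_left_cancel h1) h2⟩

omit [DecidableEq α] in
lemma walsh_comp_mul (g : FreeGroup α) (S : Finset (FreeGroup α × Fin m))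
    (x : FreeGroup α → Fin m → Bool) : walsh S (fun h => x (g * h)) = walsh (shift g S) x := by
  simp only [walsh, shift, Finset.prod_map]
  rfl

omit [DecidableEq α] in
lemma shift_shift (g h : FreeGroup α) (S : Finset (FreeGroup α × Fin m)) :
    shift g (shift h S) = shift (g * h) S := by
  simp only [shift, Finset.map_map]
  congr 1
  ext i
  · exact (mul_assoc g h i.1).symm
  · rfl

omit [DecidableEq α] in
@[simp] lemma shift_one (S : Finset (FreeGroup α × Fin m)) : shift 1 S = S := by
  ext i; simp [shift]

omit [DecidableEq α] in
@[simp] lemma shift_eq_empty {g : FreeGroup α} {S : Finset (FreeGroup α × Fin m)} :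
    shift g S = ∅ ↔ S = ∅ := by
  simp [shift]

omit [DecidableEq α] in
lemma eq_shift_iff {a : α × Bool} {S T : Finset (FreeGroup α × Fin m)} :
    S = shift (gen a) T ↔ T = shift (gen (invLetter a)) S := by
  constructor <;> rintro rfl <;> simp [shift_shift, gen_invLetter]

/-- The sum of the word lengths over a set of bits. -/
def totalNorm (S : Finset (FreeGroup α × Fin m)) : ℕ := ∑ i ∈ S, i.1.norm

lemma totalNorm_shift (a : α × Bool) (S : Finset (FreeGroup α × Fin m)) :
    totalNorm (shift (gen a) S) +
      2 * (S.filter fun i => (gen a * i.1).norm < i.1.norm).card = totalNorm S + S.card := by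
  rw [Finset.card_filter, totalNorm, totalNorm, shift, Finset.sum_map, Finset.card_eq_sum_ones,
    Finset.mul_sum, ← Finset.sum_add_distrib, ← Finset.sum_add_distrib]
  refine Finset.sum_congr rfl fun i _ => ?_
  change (gen a * i.1).norm + _ = _
  have := norm_gen_mul a i.1
  split_ifs <;> omega

/-- A nonempty set has at most two translates by letters that are not longer: such a letter
cancels against at least half of the elements, while each element cancels against one letter. -/
lemma card_totalNorm_shift_le [Fintype α] {S : Finset (FreeGroup α × Fin m)} (hS : S.Nonempty) :
    (Finset.univ.filter fun a : α × Bool =>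
      totalNorm (shift (gen a) S) ≤ totalNorm S).card ≤ 2 := by
  set Q := Finset.univ.filter fun a : α × Bool => totalNorm (shift (gen a) S) ≤ totalNorm S
  let B : α × Bool → Finset (FreeGroup α × Fin m) := fun a =>
    S.filter fun i => (gen a * i.1).norm < i.1.norm
  have h1 : ∀ a ∈ Q, S.card ≤ 2 * (B a).card := by
    intro a ha
    have h := totalNorm_shift a S
    have := (Finset.mem_filter.1 ha).2
    change _ + 2 * (B a).card = _ at h
    omega
  have h2 : ∑ a ∈ Q, (B a).card ≤ S.card := by
    rw [← Finset.card_biUnion]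
    · exact Finset.card_le_card (Finset.biUnion_subset.2 fun a _ => Finset.filter_subset _ _)
    · intro a _ b _ hab
      refine Finset.disjoint_left.2 fun i hi hi' => hab ?_
      exact eq_of_norm_gen_mul_lt (Finset.mem_filter.1 hi).2 (Finset.mem_filter.1 hi').2
  have h3 : Q.card * S.card ≤ 2 * S.card := by
    calc Q.card * S.card = ∑ a ∈ Q, S.card := by rw [Finset.sum_const, smul_eq_mul]
      _ ≤ ∑ a ∈ Q, 2 * (B a).card := Finset.sum_le_sum h1
      _ ≤ 2 * S.card := by rw [← Finset.mul_sum]; omega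
  exact Nat.le_of_mul_le_mul_right h3 hS.card_pos

/-- The norm bound for the sum of all letters, acting on families indexed by nonempty sets of bits:
orienting each edge `T — shift (gen a) T` towards the shorter set gives out-degrees at most two, to
which the Schur test applies. -/
lemma sum_shift_le [Fintype α] {t : ℕ} (ht : 0 < t) (hα : Fintype.card α = t ^ 2)
    (P : Finset (Finset (FreeGroup α × Fin m))) (hP : ∀ S ∈ P, S.Nonempty)
    (c : Finset (FreeGroup α × Fin m) → ℝ) (hc : ∀ S, 0 ≤ c S) :
    ∑ a : α × Bool, ∑ S ∈ P, ∑ T ∈ P, (if S = shift (gen a) T then c S * c T else 0) ≤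
      4 * t * ∑ S ∈ P, c S ^ 2 := by
  let w : Finset (FreeGroup α × Fin m) → Finset (FreeGroup α × Fin m) → ℝ := fun S T =>
    ∑ a : α × Bool, if S = shift (gen a) T ∧ totalNorm S ≤ totalNorm T then 1 else 0
  have hw : ∀ S T, 0 ≤ w S T := fun S T =>
    Finset.sum_nonneg fun a _ => by split_ifs <;> norm_num
  have hA : ∀ T ∈ P, ∑ S ∈ P, w S T ≤ 2 := by
    intro T hT
    rw [Finset.sum_comm]
    have : ∀ a : α × Bool, (∑ S ∈ P, if S = shift (gen a) T ∧ totalNorm S ≤ totalNorm T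
        then (1 : ℝ) else 0) ≤ if totalNorm (shift (gen a) T) ≤ totalNorm T then 1 else 0 := by
      intro a
      rw [← Finset.sum_filter]
      split_ifs with h
      · rw [Finset.sum_const, nsmul_eq_mul, mul_one]
        have : (P.filter fun S => S = shift (gen a) T ∧ totalNorm S ≤ totalNorm T) ⊆
            {shift (gen a) T} := fun S hS => by simpa using (Finset.mem_filter.1 hS).2.1
        exact_mod_cast Finset.card_le_card this
      · refine (Finset.sum_eq_zero fun S hS => ?_).le
        obtain ⟨rfl, h'⟩ := (Finset.mem_filter.1 hS).2
        exact absurd h' h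
    refine (Finset.sum_le_sum fun a _ => this a).trans ?_
    rw [Finset.sum_boole]
    exact_mod_cast card_totalNorm_shift_le (hP T hT)
  have hB : ∀ S ∈ P, ∑ T ∈ P, w S T ≤ 2 * (t : ℝ) ^ 2 := by
    intro S hS
    rw [Finset.sum_comm]
    have : ∀ a : α × Bool, (∑ T ∈ P, if S = shift (gen a) T ∧ totalNorm S ≤ totalNorm T
        then (1 : ℝ) else 0) ≤ 1 := by
      intro a
      rw [← Finset.sum_filter, Finset.sum_const, nsmul_eq_mul, mul_one]
      have : (P.filter fun T => S = shift (gen a) T ∧ totalNorm S ≤ totalNorm T) ⊆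
          {shift (gen (invLetter a)) S} := fun T hT => by
        simpa using eq_shift_iff.1 (Finset.mem_filter.1 hT).2.1
      exact_mod_cast Finset.card_le_card this
    refine (Finset.sum_le_sum fun a _ => this a).trans ?_
    simp only [Finset.sum_const, Finset.card_univ, Fintype.card_prod, Fintype.card_bool, hα,
      nsmul_eq_mul, mul_one]
    push_cast
    linarith
  have ht' : (0 : ℝ) < t := by exact_mod_cast ht
  have hschur := sum_mul_le_of_schur P w c ht' hw hA hB
  have hle : ∀ S T, (∑ a : α × Bool, if S = shift (gen a) T then c S * c T else 0) ≤
      w S T * (c S * c T) + w T S * (c T * c S) := by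
    intro S T
    have hinv : w T S = ∑ a : α × Bool,
        if S = shift (gen a) T ∧ totalNorm T ≤ totalNorm S then 1 else 0 := by
      refine Fintype.sum_equiv
        (Function.Involutive.toPerm invLetter invLetter_invLetter) _ _ fun a => ?_
      simp only [eq_shift_iff (S := T)]
      rfl
    rw [hinv, mul_comm (c T), ← add_mul, ← Finset.sum_add_distrib, Finset.sum_mul]
    refine Finset.sum_le_sum fun a _ => ?_
    have := mul_nonneg (hc S) (hc T)
    by_cases h : S = shift (gen a) T
    · rcases le_total (totalNorm S) (totalNorm T) with h' | h'
      · simp only [h, true_and] at h' ⊢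
        simp only [h', if_true]
        rw [← h]
        split_ifs <;> linarith
      · simp only [h, true_and] at h' ⊢
        simp only [h', if_true]
        rw [← h]
        split_ifs <;> linarith
    · simp [h]
  calc ∑ a : α × Bool, ∑ S ∈ P, ∑ T ∈ P, (if S = shift (gen a) T then c S * c T else 0)
      = ∑ S ∈ P, ∑ T ∈ P, ∑ a : α × Bool, (if S = shift (gen a) T then c S * c T else 0) := by
        rw [Finset.sum_comm]
        exact Finset.sum_congr rfl fun S _ => Finset.sum_comm
    _ ≤ ∑ S ∈ P, ∑ T ∈ P, (w S T * (c S * c T) + w T S * (c T * c S)) :=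
        Finset.sum_le_sum fun S _ => Finset.sum_le_sum fun T _ => hle S T
    _ = 2 * ∑ S ∈ P, ∑ T ∈ P, w S T * (c S * c T) := by
        simp only [Finset.sum_add_distrib]
        rw [Finset.sum_comm (f := fun S T => w T S * (c T * c S)), two_mul]
    _ ≤ 4 * t * ∑ S ∈ P, c S ^ 2 := by
        have : (t * 2 + 2 * (t : ℝ) ^ 2 / t) / 2 = 2 * t := by field_simp; ring
        rw [this] at hschur
        linarith

/-- Spectral gap of the shift on independent labels: a function `f` of finitely many labels is
not too anticorrelated with its translates by letters. -/
theorem sum_avg_mul_shift_ge [Fintype α] {t : ℕ} (ht : 0 < t) (hα : Fintype.card α = t ^ 2)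
    {J₀ J : Finset (FreeGroup α)} (hJ₀ : J₀ ⊆ J) (hJ : ∀ a, ∀ g ∈ J₀, gen a * g ∈ J)
    (f : (FreeGroup α → Fin m → Bool) → ℝ) (hf : ∀ x y, (∀ g ∈ J₀, x g = y g) → f x = f y) :
    2 * (t : ℝ) ^ 2 * (avg J f) ^ 2 - 4 * t * avg J (fun x => f x * f x) ≤
      ∑ a : α × Bool, avg J (fun x => f x * f fun h => x (gen a * h)) := by
  obtain ⟨c, hc⟩ := exists_walsh_expansion J₀ f hf
  set B := bitSets m J₀
  have hBJ : ∀ S ∈ B, S ∈ bitSets m J := fun S hS =>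
    mem_bitSets.2 fun i hi => hJ₀ (mem_bitSets.1 hS i hi)
  have hBJ' : ∀ a, ∀ S ∈ B, shift (gen a) S ∈ bitSets m J := by
    intro a S hS
    refine mem_bitSets.2 fun i hi => ?_
    obtain ⟨j, hj, rfl⟩ := Finset.mem_map.1 hi
    exact hJ a _ (mem_bitSets.1 hS j hj)
  have h0 : (∅ : Finset (FreeGroup α × Fin m)) ∈ B := mem_bitSets.2 (by simp)
  have havg : avg J f = c ∅ := by
    have h := avg_sum_walsh_mul_sum_walsh (J := J) B {()} c (fun _ => 1) id (fun _ => ∅) hBJ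
      (fun _ _ => hBJ _ h0)
    simp only [id, Finset.sum_singleton, walsh, Finset.prod_empty, mul_one,
      Finset.sum_ite_eq_of_mem' _ _ _ h0] at h
    rw [← h]
    exact congrArg (avg J) (funext hc)
  have hsq : avg J (fun x => f x * f x) = ∑ S ∈ B, c S ^ 2 := by
    have h := avg_sum_walsh_mul_sum_walsh (J := J) B B c c id id hBJ hBJ
    simp only [hc]
    refine h.trans (Finset.sum_congr rfl fun S hS => ?_)
    simp only [id]
    rw [Finset.sum_ite_eq_of_mem _ _ _ hS, sq]
  have hsh : ∀ a : α × Bool, avg J (fun x => f x * f fun h => x (gen a * h)) =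
      ∑ S ∈ B, ∑ T ∈ B, if S = shift (gen a) T then c S * c T else 0 := by
    intro a
    simp only [hc, walsh_comp_mul]
    exact avg_sum_walsh_mul_sum_walsh (J := J) B B c c id (shift (gen a)) hBJ (hBJ' a)
  set P := B.erase ∅
  have hP : ∀ S ∈ P, S ≠ ∅ := fun S hS => Finset.ne_of_mem_erase hS
  have hsplit : ∀ a : α × Bool,
      (∑ S ∈ B, ∑ T ∈ B, if S = shift (gen a) T then c S * c T else 0) =
        c ∅ ^ 2 + ∑ S ∈ P, ∑ T ∈ P, if S = shift (gen a) T then c S * c T else 0 := by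
    intro a
    rw [← Finset.add_sum_erase B _ h0, ← Finset.add_sum_erase B _ h0]
    congr 1
    · rw [Finset.sum_eq_zero, add_zero]
      · rw [if_pos (shift_eq_empty.2 rfl).symm, sq]
      · intro T hT
        rw [if_neg fun h => hP T hT (shift_eq_empty.1 h.symm)]
    · refine Finset.sum_congr rfl fun S hS => ?_
      rw [← Finset.add_sum_erase B _ h0, if_neg fun h => hP S hS (h.trans (shift_eq_empty.2 rfl)),
        zero_add]
  have hbound := sum_shift_le ht hα P (fun S hS => Finset.nonempty_iff_ne_empty.2 (hP S hS))
    (fun S => |c S|) (fun S => abs_nonneg _)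
  simp only [sq_abs] at hbound
  have hneg : -(∑ a : α × Bool, ∑ S ∈ P, ∑ T ∈ P,
      if S = shift (gen a) T then |c S| * |c T| else 0) ≤
      ∑ a : α × Bool, ∑ S ∈ P, ∑ T ∈ P, if S = shift (gen a) T then c S * c T else 0 := by
    simp only [← Finset.sum_neg_distrib]
    refine Finset.sum_le_sum fun a _ => Finset.sum_le_sum fun S _ => Finset.sum_le_sum fun T _ => ?_
    split_ifs
    · rw [← abs_mul]; exact neg_abs_le _
    · simp
  have hPB : ∑ S ∈ P, c S ^ 2 ≤ ∑ S ∈ B, c S ^ 2 :=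
    Finset.sum_le_sum_of_subset_of_nonneg (Finset.erase_subset _ _) fun _ _ _ => sq_nonneg _
  simp only [hsh, hsplit, hsq, havg]
  rw [Finset.sum_add_distrib]
  simp only [Finset.sum_const, Finset.card_univ, Fintype.card_prod, Fintype.card_bool, hα,
    nsmul_eq_mul]
  push_cast
  have : (4 : ℝ) * t * ∑ S ∈ P, c S ^ 2 ≤ 4 * t * ∑ S ∈ B, c S ^ 2 := by gcongr
  linarith

end Shift

/-! ### Simulating an algorithm on the infinite tree -/

/-- A numbering of the letters, used as the port numbering of the Cayley tree. -/
noncomputable def letterCode (d : ℕ) : Fin d × Bool ≃ Fin (2 * d) :=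
  Fintype.equivFinOfCardEq (by simp [mul_comm])

section Simulate

variable {κ β : Type} {d : ℕ}

/-- The strategy `s`, run with at most `q` probes on the Cayley tree in which the vertex `g` has the
identifier `enc (x g)` for a labelling `x`, as a query tree for `x`. The partial function `known`
finds the discovered vertices by their identifiers; an inadmissible probe ends the run with `none`.
-/
noncomputable def simulate (enc : κ → ℕ) :
    ℕ → Strategy β → (ℕ → Option (FreeGroup (Fin d))) →
      QueryTree (FreeGroup (Fin d)) κ (Option β)
  | _, .output b, _ => .leaf (some b)
  | 0, .probe _ _ _, _ => .leaf none
  | q + 1, .probe i p next, known =>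
    if h : p < 2 * d then
      match known i with
      | none => .leaf none
      | some u =>
        .query (u * gen ((letterCode d).symm ⟨p, h⟩)) fun k =>
          simulate enc q
            (next (enc k) (2 * d) (letterCode d (invLetter ((letterCode d).symm ⟨p, h⟩))))
            (Function.update known (enc k) (some (u * gen ((letterCode d).symm ⟨p, h⟩))))
    else .leaf none

/-- The answer of `A` to the query of the vertex `g` of the Cayley tree, as a query tree. -/
noncomputable def simulateAt (enc : κ → ℕ) (A : Algorithm β) (n q : ℕ) (g : FreeGroup (Fin d)) :
    QueryTree (FreeGroup (Fin d)) κ (Option β) :=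
  .query g fun k => simulate enc q (A n (enc k) (2 * d))
    (Function.update (fun _ => none) (enc k) (some g))

lemma depthLE_simulate (enc : κ → ℕ) (q : ℕ) :
    ∀ (s : Strategy β) (known : ℕ → Option (FreeGroup (Fin d))),
      (simulate enc q s known).DepthLE q := by
  induction q with
  | zero =>
    intro s known
    cases s <;> trivial
  | succ q ih =>
    intro s known
    cases s with
    | output b => trivial
    | probe i p next =>
      rw [simulate]
      split_ifs
      · split
        · trivial
        · exact fun k => ih _ _
      · trivial

lemma depthLE_simulateAt (enc : κ → ℕ) (A : Algorithm β) (n q : ℕ) (g : FreeGroup (Fin d)) :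
    (simulateAt enc A n q g).DepthLE (q + 1) :=
  fun _ => depthLE_simulate _ _ _ _

lemma eval_simulate_map (enc : κ → ℕ) (x : FreeGroup (Fin d) → κ) (h : FreeGroup (Fin d)) (q : ℕ) :
    ∀ (s : Strategy β) (known : ℕ → Option (FreeGroup (Fin d))),
      (simulate enc q s fun i => (known i).map (h * ·)).eval x =
        (simulate enc q s known).eval fun g => x (h * g) := by
  induction q with
  | zero =>
    intro s known
    cases s <;> rfl
  | succ q ih =>
    intro s known
    cases s with
    | output b => rfl
    | probe i p next =>
      rw [simulate, simulate]
      split_ifs with hp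
      · cases hi : known i with
        | none => rfl
        | some u =>
          simp only [Option.map_some, QueryTree.eval]
          rw [← ih]
          simp only [mul_assoc]
          congr 2
          ext1 j
          by_cases hj : j = enc (x (h * (u * gen ((letterCode d).symm ⟨p, hp⟩))))
          · subst hj; simp
          · simp [hj]
      · rfl

/-- The answers at different vertices are translates of each other. -/
lemma eval_simulateAt (enc : κ → ℕ) (A : Algorithm β) (n q : ℕ) (h : FreeGroup (Fin d))
    (x : FreeGroup (Fin d) → κ) :
    (simulateAt enc A n q h).eval x = (simulateAt enc A n q 1).eval fun g => x (h * g) := by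
  simp only [simulateAt, QueryTree.eval, mul_one]
  rw [← eval_simulate_map]
  congr 2
  ext1 j
  by_cases hj : j = enc (x h)
  · subst hj; simp
  · simp [hj]

/-- A set of vertices of the Cayley tree that contains the parent of each of its members. -/
def ParentClosed (W : Finset (FreeGroup (Fin d))) : Prop :=
  ∀ g ∈ W, ∀ a, (g * gen a).norm < g.norm → g * gen a ∈ W

lemma parentClosed_singleton : ParentClosed ({1} : Finset (FreeGroup (Fin d))) := by
  intro g hg a h
  rw [Finset.mem_singleton.1 hg, FreeGroup.norm_one] at h
  exact (Nat.not_lt_zero _ h).elim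

lemma ParentClosed.mul_gen {W : Finset (FreeGroup (Fin d))} (hW : ParentClosed W)
    {u : FreeGroup (Fin d)} (hu : u ∈ W) {a b : Fin d × Bool}
    (h : (u * gen a * gen b).norm < (u * gen a).norm) :
    u * gen a ∈ W ∨ u * gen a * gen b ∈ W := by
  rcases norm_mul_gen a u with h' | h'
  · exact .inl (hW u hu a (by omega))
  · right
    have : b = invLetter a := eq_of_norm_mul_gen_lt h (by simp [h'])
    simpa [this] using hu

lemma ParentClosed.insert_mul_gen {W : Finset (FreeGroup (Fin d))} (hW : ParentClosed W)
    {u : FreeGroup (Fin d)} (hu : u ∈ W) (a : Fin d × Bool) :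
    ParentClosed (insert (u * gen a) W) := by
  intro g hg b hb
  rcases Finset.mem_insert.1 hg with rfl | hg
  · rcases hW.mul_gen hu hb with h | h
    · exact Finset.mem_insert_of_mem (hW _ h b hb)
    · exact Finset.mem_insert_of_mem h
  · exact Finset.mem_insert_of_mem (hW g hg b hb)

lemma ParentClosed.union_visited_simulate (enc : κ → ℕ) (x : FreeGroup (Fin d) → κ) (q : ℕ) :
    ∀ (s : Strategy β) (known : ℕ → Option (FreeGroup (Fin d))) (R : Finset (FreeGroup (Fin d))),
      ParentClosed R → (∀ i g, known i = some g → g ∈ R) →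
      ParentClosed (R ∪ (simulate enc q s known).visited x) := by
  induction q with
  | zero =>
    intro s known R hR _
    cases s <;> simpa [simulate, QueryTree.visited] using hR
  | succ q ih =>
    intro s known R hR hk
    cases s with
    | output b => simpa [simulate, QueryTree.visited] using hR
    | probe i p next =>
      rw [simulate]
      split_ifs with hp
      · split
        · simpa [QueryTree.visited] using hR
        · rename_i u hu
          rw [QueryTree.visited, Finset.union_insert, ← Finset.insert_union]
          refine ih _ _ _ (hR.insert_mul_gen (hk i u hu) _) fun j g hj => ?_
          rw [Function.update_apply] at hj
          split_ifs at hj with hjk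
          · simp [Option.some.inj hj]
          · exact Finset.mem_insert_of_mem (hk j g hj)
      · simpa [QueryTree.visited] using hR

/-- The region explored by the queries of `1` and of a neighbor. -/
lemma parentClosed_visited_simulateAt (enc : κ → ℕ) (A : Algorithm β) (n q : ℕ) (a : Fin d × Bool)
    (x : FreeGroup (Fin d) → κ) :
    ParentClosed ((simulateAt enc A n q 1).visited x ∪
      (simulateAt enc A n q (gen a)).visited x) := by
  have hk : ∀ (k : κ) (g : FreeGroup (Fin d)) (R : Finset (FreeGroup (Fin d))), g ∈ R →
      ∀ i h, Function.update (fun _ => none) (enc k) (some g) i = some h → h ∈ R := by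
    intro k g R hg i h hi
    rw [Function.update_apply] at hi
    split_ifs at hi
    exact Option.some.inj hi ▸ hg
  simp only [simulateAt, QueryTree.visited]
  rw [Finset.union_insert, ← Finset.insert_union]
  refine ParentClosed.union_visited_simulate enc x q _ _ _ ?_
    (hk _ _ _ (Finset.mem_insert_self _ _))
  rw [← one_mul (gen a)]
  refine ParentClosed.insert_mul_gen ?_ (Finset.mem_insert_self _ _) a
  rw [Finset.insert_eq]
  exact ParentClosed.union_visited_simulate enc x q _ _ _ parentClosed_singleton
    (hk _ _ _ (Finset.mem_singleton_self _))

lemma ParentClosed.union_neighbors {U : Finset (FreeGroup (Fin d))} (hU : ParentClosed U) :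
    ParentClosed (U ∪ (U ×ˢ Finset.univ).image fun p : _ × (Fin d × Bool) => p.1 * gen p.2) := by
  intro g hg b hb
  rcases Finset.mem_union.1 hg with hg | hg
  · exact Finset.mem_union_left _ (hU g hg b hb)
  · obtain ⟨⟨u, a⟩, hu, rfl⟩ := Finset.mem_image.1 hg
    have hu' : u ∈ U := (Finset.mem_product.1 hu).1
    rcases hU.mul_gen hu' hb with h | h
    · exact Finset.mem_union_left _ (hU _ h b hb)
    · exact Finset.mem_union_left _ h

lemma card_union_neighbors_le (U : Finset (FreeGroup (Fin d))) :
    (U ∪ (U ×ˢ Finset.univ).image fun p : _ × (Fin d × Bool) => p.1 * gen p.2).card ≤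
      U.card * (2 * d + 1) := by
  refine (Finset.card_union_le _ _).trans ?_
  have := Finset.card_image_le (s := U ×ˢ (Finset.univ : Finset (Fin d × Bool)))
    (f := fun p => p.1 * gen p.2)
  rw [Finset.card_product, Finset.card_univ, Fintype.card_prod, Fintype.card_fin,
    Fintype.card_bool] at this
  linarith

/-- A parent-closed set can be enlarged by a shortest vertex outside of it. -/
lemma ParentClosed.exists_superset_card_eq (hd : 0 < d) {V : Finset (FreeGroup (Fin d))}
    (hV : ParentClosed V) {n : ℕ} (hn : V.card ≤ n) : ∃ W, V ⊆ W ∧ ParentClosed W ∧ W.card = n := by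
  induction n, hn using Nat.le_induction with
  | base => exact ⟨V, subset_rfl, hV, rfl⟩
  | succ n _ ih =>
    obtain ⟨W, hVW, hW, rfl⟩ := ih
    have : Nonempty (Fin d) := ⟨⟨0, hd⟩⟩
    have : Infinite (FreeGroup (Fin d)) := Infinite.of_surjective _ FreeGroup.norm_surjective
    obtain ⟨g₀, hg₀⟩ := Infinite.exists_notMem_finset W
    let g := Function.argminOn FreeGroup.norm {g | g ∉ W} ⟨g₀, hg₀⟩
    have hg : g ∉ W := Function.argminOn_mem FreeGroup.norm {g | g ∉ W} ⟨g₀, hg₀⟩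
    refine ⟨insert g W, hVW.trans (Finset.subset_insert _ _), ?_, Finset.card_insert_of_notMem hg⟩
    intro h hh a ha
    rcases Finset.mem_insert.1 hh with rfl | hh
    · refine Finset.mem_insert_of_mem ?_
      by_contra hcon
      exact Function.not_lt_argminOn FreeGroup.norm {g | g ∉ W} hcon ha
    · exact Finset.mem_insert_of_mem (hW h hh a ha)

end Simulate

/-! ### Finite trees that look like the explored part of the infinite tree -/

section LooksLike

variable {d n : ℕ}

/-- `N` is embedded by `φ` into the Cayley tree and looks, from all vertices over `U`, like the
Cayley tree with identifiers `ids`. -/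
structure LooksLike (N : Network (Fin n)) (φ : Fin n → FreeGroup (Fin d))
    (U : Finset (FreeGroup (Fin d))) (ids : FreeGroup (Fin d) → ℕ) : Prop where
  injective : Function.Injective φ
  ident_injective : Function.Injective N.ident
  adj_iff : ∀ u w, N.graph.Adj u w ↔ ∃ a, φ w = φ u * gen a
  exists_eq : ∀ g ∈ U, ∃ v, φ v = g
  ident_eq : ∀ v, φ v ∈ U → N.ident v = ids (φ v)
  deg_eq : ∀ v, φ v ∈ U → N.deg v = 2 * d
  neighbor_eq : ∀ v, φ v ∈ U → ∀ p : Fin (N.deg v), ∃ a, (letterCode d a : ℕ) = p ∧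
    φ (N.neighbor v p) = φ v * gen a

/-- A parent-closed set containing the root spans a subtree of the Cayley tree. -/
lemma isTree_comap {W : Finset (FreeGroup (Fin d))} (h1 : 1 ∈ W) (hW : ParentClosed W)
    {φ : Fin n → FreeGroup (Fin d)} (hφ : Function.Injective φ) (hφW : ∀ g, g ∈ W ↔ ∃ v, φ v = g) :
    ((cayley (Fin d)).comap φ).IsTree := by
  obtain ⟨o, ho⟩ := (hφW 1).1 h1
  have : Nonempty (Fin n) := ⟨o⟩
  have key : ∀ r v, (φ v).norm ≤ r → ((cayley (Fin d)).comap φ).Reachable v o := by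
    intro r
    induction r with
    | zero =>
      intro v hv
      have : φ v = 1 := FreeGroup.norm_eq_zero.1 (Nat.le_zero.1 hv)
      rw [hφ (this.trans ho.symm)]
    | succ r ih =>
      intro v hv
      by_cases hv1 : φ v = 1
      · rw [hφ (hv1.trans ho.symm)]
      · obtain ⟨a, ha⟩ := exists_norm_mul_gen_lt hv1
        obtain ⟨w, hw⟩ := (hφW _).1 (hW _ ((hφW _).2 ⟨v, rfl⟩) a ha)
        have hadj : ((cayley (Fin d)).comap φ).Adj v w := ⟨a, hw⟩
        exact hadj.reachable.trans (ih w (by rw [hw]; omega))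
  refine ⟨⟨fun u v => (key _ u le_rfl).trans (key _ v le_rfl).symm⟩, ?_⟩
  exact (cayley_isAcyclic (Fin d)).of_comap ⟨φ, hφ⟩

/-- A parent-closed set `W` of `n` vertices spans an admissible input that looks like the Cayley tree
from all vertices whose neighbors belong to `W`. -/
lemma exists_isTreeInput_looksLike {k : ℕ} {U W : Finset (FreeGroup (Fin d))} (hUW : U ⊆ W)
    (h1 : 1 ∈ W) (hW : ParentClosed W) (hcard : W.card = n) (hU : ∀ u ∈ U, ∀ a, u * gen a ∈ W)
    {ids : FreeGroup (Fin d) → ℕ} (hid : Set.InjOn ids U)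
    (hmem : ∀ g ∈ U, ids g ∈ Set.Icc 1 (n ^ k))
    (hn : n ≤ n ^ k) :
    ∃ (N : Network (Fin n)) (φ : Fin n → FreeGroup (Fin d)), N.IsTreeInput (2 * d) k ∧
      LooksLike N φ U ids := by
  classical
  let e := Finset.equivFinOfCardEq hcard
  let φ : Fin n → FreeGroup (Fin d) := fun v => e.symm v
  have hφ : Function.Injective φ := Subtype.val_injective.comp e.symm.injective
  have hφW : ∀ g, g ∈ W ↔ ∃ v, φ v = g := fun g =>
    ⟨fun h => ⟨e ⟨g, h⟩, by simp [φ]⟩, fun ⟨v, hv⟩ => hv ▸ (e.symm v).2⟩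
  let G := (cayley (Fin d)).comap φ
  -- The vertices outside of `U` receive arbitrary unused identifiers.
  obtain ⟨ι, hι, hιmem, hιU⟩ : ∃ ι : Fin n → ℕ, Function.Injective ι ∧
      (∀ v, ι v ∈ Set.Icc 1 (n ^ k)) ∧ ∀ v, φ v ∈ U → ι v = ids (φ v) := by
    let s : Finset (Fin n) := Finset.univ.filter fun v => φ v ∈ U
    have hs : Set.InjOn (fun v => ids (φ v)) s := fun v hv w hw h =>
      hφ (hid (Finset.mem_filter.1 hv).2 (Finset.mem_filter.1 hw).2 h)
    have hsub : s.image (fun v => ids (φ v)) ⊆ Finset.Icc 1 (n ^ k) := fun i hi => by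
      obtain ⟨v, hv, rfl⟩ := Finset.mem_image.1 hi
      exact Finset.mem_Icc.2 (hmem _ (Finset.mem_filter.1 hv).2)
    obtain ⟨t, hst, ht, htn⟩ := Finset.exists_subsuperset_card_eq (n := n) hsub
      (Finset.card_image_le.trans ((Finset.card_le_univ s).trans (Fintype.card_fin n).le))
      (by simpa using hn)
    obtain ⟨g, hg⟩ := Finset.exists_equiv_extend_of_card_eq (by simp [htn]) hst hs
    refine ⟨fun v => g v, Subtype.val_injective.comp g.injective, fun v => ?_, fun v hv => ?_⟩
    · exact Finset.mem_Icc.1 (ht (g v).2)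
    · exact hg v (Finset.mem_filter.2 ⟨Finset.mem_univ v, hv⟩)
  have hport : ∀ v, ∃ (D : ℕ) (p : Fin D ≃ G.neighborSet v), D ≤ 2 * d ∧ (φ v ∈ U → D = 2 * d ∧
      ∀ i : Fin D, ∃ a, (letterCode d a : ℕ) = i ∧ φ (p i) = φ v * gen a) := by
    intro v
    have hletter : ∀ w : G.neighborSet v, ∃ a, φ w = φ v * gen a := fun w => w.2
    choose l hl using hletter
    have hl_inj : Function.Injective l := fun w w' h =>
      Subtype.ext (hφ (by rw [hl, hl, h]))
    by_cases hv : φ v ∈ U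
    · have hl_surj : Function.Surjective l := by
        intro a
        obtain ⟨w, hw⟩ := (hφW _).1 (hU _ hv a)
        refine ⟨⟨w, a, hw⟩, gen_injective (mul_left_cancel (a := φ v) ?_)⟩
        rw [← hl, hw]
      let p := (Equiv.ofBijective l ⟨hl_inj, hl_surj⟩).trans (letterCode d)
      refine ⟨2 * d, p.symm, le_rfl, fun _ => ⟨rfl, fun i => ⟨l (p.symm i), ?_, hl _⟩⟩⟩
      exact congrArg Fin.val (p.apply_symm_apply i)
    · refine ⟨_, (Finite.equivFin (G.neighborSet v)).symm, ?_, fun h => absurd h hv⟩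
      have := Nat.card_le_card_of_injective l hl_inj
      simpa [mul_comm] using this
  choose D p hD hp using hport
  refine ⟨⟨G, ι, D, p⟩, φ, ⟨isTree_comap h1 hW hφ hφW, hD, hι, hιmem⟩, ?_⟩
  exact ⟨hφ, hι, fun u w => Iff.rfl, fun g hg => (hφW g).1 (hUW hg), hιU,
    fun v hv => (hp v hv).1, fun v hv i => (hp v hv).2 i⟩

lemma Network.neighbor_backPort {V : Type*} (N : Network V) (u : V) (p : Fin (N.deg u)) :
    N.neighbor (N.neighbor u p) (N.backPort u p) = u := by
  change ((N.port (N.neighbor u p)) ((N.port (N.neighbor u p)).symm ⟨u, _⟩)).1 = u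
  rw [Equiv.apply_symm_apply]

/-- The simulation on the infinite tree gives the same answers as the run on a finite tree, if that
looks like the infinite tree from all vertices explored. -/
lemma eval_simulate_of_run {κ β : Type} {N : Network (Fin n)} {φ : Fin n → FreeGroup (Fin d)}
    {U : Finset (FreeGroup (Fin d))} {enc : κ → ℕ} {x : FreeGroup (Fin d) → κ}
    (hN : LooksLike N φ U fun g => enc (x g)) {S : Set (Fin n)} {s : Strategy β} {t : ℕ} {b : β}
    (hrun : N.Run S s t b) :
    ∀ (q : ℕ) (known : ℕ → Option (FreeGroup (Fin d))), t ≤ q →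
      (∀ u ∈ S, φ u ∈ U ∧ known (N.ident u) = some (φ u)) →
      (simulate enc q s known).visited x ⊆ U → (simulate enc q s known).eval x = some b := by
  induction hrun with
  | output S b =>
    intro q known _ _ _
    cases q <;> rfl
  | probe S u hu p next t b _ ih =>
    intro q known htq hS hvis
    obtain ⟨q, rfl⟩ : ∃ q', q = q' + 1 := ⟨q - 1, by omega⟩
    obtain ⟨huU, hku⟩ := hS u hu
    obtain ⟨a, hap, ha⟩ := hN.neighbor_eq u huU p
    have hp : (p : ℕ) < 2 * d := hap ▸ (letterCode d a).2
    have hsymm : (letterCode d).symm ⟨p, hp⟩ = a := by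
      rw [Equiv.symm_apply_eq]; exact Fin.ext hap.symm
    simp only [simulate, dif_pos hp, hku, hsymm, QueryTree.visited, QueryTree.eval,
      Finset.insert_subset_iff] at hvis ⊢
    rw [← ha] at hvis ⊢
    set w := N.neighbor u p with hw
    obtain ⟨hwU, hvis⟩ := hvis
    obtain ⟨a', hap', ha'⟩ := hN.neighbor_eq w hwU (N.backPort u p)
    have hback : N.neighbor w (N.backPort u p) = u := N.neighbor_backPort u p
    have haa' : a' = invLetter a := by
      rw [hback, ha, mul_assoc] at ha'
      refine gen_injective ?_
      rw [gen_invLetter]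
      exact eq_inv_of_mul_eq_one_right (left_eq_mul.1 ha')
    rw [← hN.ident_eq w hwU, ← haa', hap', ← hN.deg_eq w hwU] at hvis ⊢
    refine ih q _ (by omega) ?_ hvis
    intro v hv
    by_cases hvw : v = w
    · subst hvw
      exact ⟨hwU, by simp⟩
    · have hvS := hS v (hv.resolve_left hvw)
      refine ⟨hvS.1, ?_⟩
      rw [Function.update_of_ne (hN.ident_injective.ne hvw)]
      exact hvS.2

/-- If the identifiers met by the queries of `1` and of a neighbor are distinct, then the algorithm
gives different colors to these vertices of the infinite tree. -/
lemma exists_eval_simulateAt_ne {κ : Type} {c Δ k q : ℕ} (hd : 0 < d) (hΔ : 2 * d ≤ Δ)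
    {A : Algorithm (Fin c)} (hA : ColorsTrees c Δ k n q A) (hq : (2 * q + 2) * (2 * d + 1) ≤ n)
    (hk : 1 ≤ k) {enc : κ → ℕ} (henc : Function.Injective enc)
    (hmem : ∀ l, enc l ∈ Set.Icc 1 (n ^ k)) (a : Fin d × Bool) (x : FreeGroup (Fin d) → κ)
    (hx : Set.InjOn x ↑((simulateAt enc A n q 1).visited x ∪
      (simulateAt enc A n q (gen a)).visited x)) :
    ∃ i j, i ≠ j ∧ (simulateAt enc A n q 1).eval x = some i ∧
      (simulateAt enc A n q (gen a)).eval x = some j := by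
  set U := (simulateAt enc A n q 1).visited x ∪ (simulateAt enc A n q (gen a)).visited x with hU
  have hUc : ParentClosed U := parentClosed_visited_simulateAt enc A n q a x
  have h1U : (1 : FreeGroup (Fin d)) ∈ U :=
    Finset.mem_union_left _ (Finset.mem_insert_self _ _)
  have hUcard : U.card ≤ 2 * q + 2 := by
    have h := Finset.card_union_le ((simulateAt enc A n q 1).visited x)
      ((simulateAt enc A n q (gen a)).visited x)
    rw [← hU] at h
    have h1 := QueryTree.card_visited_le x (depthLE_simulateAt enc A n q (1 : FreeGroup (Fin d)))
    have h2 := QueryTree.card_visited_le x (depthLE_simulateAt enc A n q (gen a))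
    omega
  obtain ⟨W, hVW, hW, hWn⟩ := hUc.union_neighbors.exists_superset_card_eq hd
    ((card_union_neighbors_le U).trans ((Nat.mul_le_mul_right _ hUcard).trans hq))
  have hUW : U ⊆ W := Finset.subset_union_left.trans hVW
  obtain ⟨N, φ, hN, hlook⟩ := exists_isTreeInput_looksLike (k := k) hUW (hUW h1U) hW hWn
    (fun u hu b => hVW (Finset.mem_union_right _ (Finset.mem_image.2
      ⟨(u, b), Finset.mem_product.2 ⟨hu, Finset.mem_univ b⟩, rfl⟩)))
    (ids := fun g => enc (x g)) (fun g hg h hh hgh => hx hg hh (henc hgh)) (fun g _ => hmem _)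
    (Nat.le_self_pow (by omega) n)
  obtain ⟨col, hcol⟩ := hA N ⟨hN.isTree, fun v => (hN.deg_le v).trans hΔ, hN.ident_injective,
    hN.ident_mem⟩
  have key : ∀ v, (simulateAt enc A n q (φ v)).visited x ⊆ U →
      (simulateAt enc A n q (φ v)).eval x = some (col v) := by
    intro v hv
    obtain ⟨t, htq, hrun⟩ := hcol v
    simp only [simulateAt, QueryTree.visited, QueryTree.eval, Finset.insert_subset_iff] at hv ⊢
    obtain ⟨hvU, hv⟩ := hv
    have hid : N.ident v = enc (x (φ v)) := hlook.ident_eq v hvU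
    rw [Network.Answers, hid, hlook.deg_eq v hvU] at hrun
    refine eval_simulate_of_run hlook hrun q _ htq ?_ hv
    rintro u rfl
    exact ⟨hvU, by simp [hid]⟩
  obtain ⟨v, hv⟩ := hlook.exists_eq 1 h1U
  obtain ⟨w, hw⟩ := hlook.exists_eq (gen a)
    (Finset.mem_union_right _ (Finset.mem_insert_self _ _))
  refine ⟨col v, col w, col.valid ((hlook.adj_iff v w).2 ⟨a, by rw [hv, hw, one_mul]⟩), ?_, ?_⟩
  · rw [← hv]
    exact key v (hv ▸ Finset.subset_union_left)
  · rw [← hw]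
    exact key w (hw ▸ Finset.subset_union_right)

end LooksLike

/-! ### The lower bound -/

/-- There is no approximate coloring of the shift with few colors: some letter `a` has a probability
more than `1 / (4 * c)` that the colors of `x` and of its translate by `a` do not both exist and
differ, `bad a` being an upper bound for the indicator of this event. -/
lemma exists_lt_avg_of_shift_coloring {c m : ℕ} (hc : 2 ≤ c) {α : Type} [DecidableEq α] [Fintype α]
    (hα : Fintype.card α = (5 * c) ^ 2) {J₀ J : Finset (FreeGroup α)} (hJ₀ : J₀ ⊆ J)
    (hJ : ∀ a, ∀ g ∈ J₀, gen a * g ∈ J) (col : (FreeGroup α → Fin m → Bool) → Option (Fin c))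
    (hcol : ∀ x y, (∀ g ∈ J₀, x g = y g) → col x = col y)
    (bad : α × Bool → (FreeGroup α → Fin m → Bool) → ℝ)
    (hbad : ∀ a x, bad a x = 0 ∧ (∃ i j, i ≠ j ∧ col x = some i ∧
      col (fun g => x (gen a * g)) = some j) ∨ 1 ≤ bad a x) :
    ∃ a, 1 / (4 * (c : ℝ)) < avg J (bad a) := by
  by_contra! hcon
  let f : Fin c → (FreeGroup α → Fin m → Bool) → ℝ := fun i x => if col x = some i then 1 else 0
  have hf0 : ∀ i x, 0 ≤ f i x := fun i x => by simp only [f]; split_ifs <;> norm_num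
  have hf1 : ∀ i x, f i x ≤ 1 := fun i x => by simp only [f]; split_ifs <;> norm_num
  have hff : ∀ i x, f i x * f i x = f i x := fun i x => by simp only [f]; split_ifs <;> norm_num
  have hsum : ∀ x, ∑ i, f i x = if col x = none then 0 else 1 := by
    intro x
    cases h : col x with
    | none => simp [f, h]
    | some i => simp [f, h]
  have hsum1 : ∀ x, ∑ i, f i x ≤ 1 := fun x => by rw [hsum]; split_ifs <;> norm_num
  have hprod : ∀ a x, ∑ i, f i x * f i (fun g => x (gen a * g)) ≤ bad a x := by
    intro a x
    rcases hbad a x with ⟨h0, i, j, hij, hi, hj⟩ | h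
    · rw [h0]
      refine (Finset.sum_eq_zero fun l _ => ?_).le
      simp only [f, hi, hj, Option.some.injEq]
      by_cases h1 : i = l
      · rw [if_neg fun h2 : j = l => hij (h1.trans h2.symm), mul_zero]
      · rw [if_neg h1, zero_mul]
    · refine le_trans (Finset.sum_le_sum fun i _ => ?_) ((hsum1 x).trans h)
      exact mul_le_of_le_one_right (hf0 i x) (hf1 i _)
  have hcpos : (0 : ℝ) < c := by exact_mod_cast (by omega : 0 < c)
  have hc2 : (2 : ℝ) ≤ c := by exact_mod_cast hc
  have hgap : ∀ i, _ := fun i => sum_avg_mul_shift_ge (t := 5 * c) (by omega) hα hJ₀ hJ (f i)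
    (fun x y h => by simp only [f, hcol x y h])
  simp only [hff] at hgap
  have hupper : ∑ i, ∑ a : α × Bool, avg J (fun x => f i x * f i fun g => x (gen a * g)) ≤
      2 * ((5 * c : ℕ) : ℝ) ^ 2 * (1 / (4 * c)) := by
    rw [Finset.sum_comm]
    have : ∀ a : α × Bool, ∑ i, avg J (fun x => f i x * f i fun g => x (gen a * g)) ≤
        1 / (4 * c) := fun a => by
      rw [← avg_sum]
      exact (avg_mono (hprod a)).trans (hcon a)
    refine (Finset.sum_le_sum fun a _ => this a).trans (le_of_eq ?_)
    simp only [Finset.sum_const, Finset.card_univ, Fintype.card_prod, Fintype.card_bool, hα,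
      nsmul_eq_mul]
    push_cast
    ring
  have hlower := Finset.sum_le_sum fun i (_ : i ∈ Finset.univ) => hgap i
  rw [Finset.sum_sub_distrib, ← Finset.mul_sum, ← Finset.mul_sum] at hlower
  have htotal : ∑ i, avg J (f i) ≤ 1 := by
    rw [← avg_sum]
    exact (avg_mono hsum1).trans (avg_const _ _).le
  have htotal' : 1 - 1 / (4 * (c : ℝ)) ≤ ∑ i, avg J (f i) := by
    have : Nonempty α := Fintype.card_pos_iff.1 (by rw [hα]; positivity)
    let a₀ : α × Bool := (Classical.arbitrary α, true)
    have h : avg J (fun _ : FreeGroup α → Fin m → Bool => (1 : ℝ)) ≤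
        avg J (fun x => ∑ i, f i x + bad a₀ x) := by
      refine avg_mono fun x => ?_
      rcases hbad a₀ x with ⟨h0, i, j, -, hi, -⟩ | h
      · rw [hsum, hi, h0]; simp
      · have : 0 ≤ ∑ i, f i x := Finset.sum_nonneg fun i _ => hf0 i x
        linarith
    rw [avg_const, avg_add, avg_sum] at h
    linarith [hcon a₀]
  have hcs := sq_sum_le_card_mul_sum_sq (s := Finset.univ) (f := fun i => avg J (f i))
  rw [Finset.card_univ, Fintype.card_fin] at hcs
  set μ := ∑ i, avg J (f i)
  set Q := ∑ i, avg J (f i) ^ 2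
  have h8 : 1 / (4 * (c : ℝ)) ≤ 1 / 8 := by
    rw [div_le_div_iff₀ (by positivity) (by norm_num)]; linarith
  -- With `t = 5 * c` the spectral gap gives `50 * c * μ ^ 2 - 20 * c * μ ≤ 25 / 2 * c`, which fails
  -- for `7 / 8 ≤ μ ≤ 1`.
  have hμ : (7 / 8 : ℝ) ^ 2 ≤ μ ^ 2 := pow_le_pow_left₀ (by norm_num) (by linarith) 2
  have e : 2 * ((5 * c : ℕ) : ℝ) ^ 2 * (1 / (4 * c)) = 25 / 2 * c := by
    push_cast; field_simp; norm_num
  have h := hlower.trans hupper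
  rw [e] at h
  push_cast at h
  nlinarith

/-- An injective numbering of the labels from `1` on. -/
noncomputable def labelCode (m : ℕ) (l : Fin m → Bool) : ℕ :=
  Fintype.equivFin (Fin m → Bool) l + 1

lemma labelCode_injective (m : ℕ) : Function.Injective (labelCode m) := fun _ _ h =>
  (Fintype.equivFin _).injective (Fin.ext (Nat.succ_injective h))

lemma labelCode_mem (m : ℕ) (l : Fin m → Bool) : labelCode m l ∈ Set.Icc 1 (2 ^ m) := by
  refine ⟨Nat.succ_pos _, (Fintype.equivFin (Fin m → Bool) l).2.trans_eq ?_⟩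
  rw [Fintype.card_fun, Fintype.card_bool, Fintype.card_fin]

/-- The birthday bound makes an algorithm with few probes an approximate coloring of the shift. -/
lemma lt_probes {c Δ k n q : ℕ} (hc : 2 ≤ c) (hΔ : 2 * (5 * c) ^ 2 ≤ Δ) (hk : 10 ≤ k)
    (hn : 8 * c ≤ n) {A : Algorithm (Fin c)} (hA : ColorsTrees c Δ k n q A) :
    n < (2 * q + 2) * (2 * (5 * c) ^ 2 + 1) := by
  classical
  by_contra! hq
  set d := (5 * c) ^ 2 with hd
  have hd0 : 0 < d := by positivity
  have hn0 : 0 < n := by omega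
  let m := Nat.log 2 (n ^ 10)
  have hm : 2 ^ m ≤ n ^ 10 := Nat.pow_log_le_self 2 (by positivity)
  have hm' : n ^ 10 < 2 ^ (m + 1) := Nat.lt_pow_succ_log_self (by norm_num) _
  let T : FreeGroup (Fin d) → QueryTree (FreeGroup (Fin d)) (Fin m → Bool) (Option (Fin c)) :=
    simulateAt (labelCode m) A n q
  let J₀ := (T 1).support
  let J := J₀ ∪ Finset.univ.biUnion fun a : Fin d × Bool =>
    J₀.image (gen a * ·) ∪ ((T 1).andThen (T (gen a))).support
  have hT : ∀ g x, (T g).eval x = (T 1).eval fun h => x (g * h) := fun g x =>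
    eval_simulateAt _ _ _ _ _ _
  obtain ⟨a, ha⟩ := exists_lt_avg_of_shift_coloring (m := m) (α := Fin d) (J₀ := J₀) (J := J) hc
    (by simp [hd]) Finset.subset_union_left
    (fun a g hg => Finset.mem_union_right _ (Finset.mem_biUnion.2 ⟨a, Finset.mem_univ _,
      Finset.mem_union_left _ (Finset.mem_image_of_mem _ hg)⟩))
    (T 1).eval (fun x y h => QueryTree.eval_congr _ h)
    (fun a x => if Set.InjOn x ((T 1).andThen (T (gen a))|>.visited x) then 0 else 1)
    (fun a x => by
      split_ifs with h
      · left
        rw [QueryTree.visited_andThen] at h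
        obtain ⟨i, j, hij, hi, hj⟩ := exists_eval_simulateAt_ne hd0 hΔ hA hq (by omega)
          (labelCode_injective m) (fun l => ⟨(labelCode_mem m l).1, (labelCode_mem m l).2.trans
            (hm.trans (Nat.pow_le_pow_right hn0 hk))⟩) a x h
        exact ⟨rfl, i, j, hij, hi, (hT _ _).symm.trans hj⟩
      · exact .inr le_rfl)
  have hcoll := avg_collision_le (J := J) (2 * q + 2) ((T 1).andThen (T (gen a))) ∅
    (fun _ => default)
    (((depthLE_simulateAt _ A n q (gen a)).andThen (depthLE_simulateAt _ A n q 1)).mono (by omega))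
    (fun g hg => Finset.mem_union_right _ (Finset.mem_biUnion.2 ⟨a, Finset.mem_univ _,
      Finset.mem_union_right _ hg⟩)) (by simp)
  simp only [Finset.piecewise_empty, Finset.empty_union, Finset.card_empty, Fintype.card_fun,
    Fintype.card_bool, Fintype.card_fin] at hcoll
  have h := ha.trans_le hcoll
  have hc0 : (0 : ℝ) < c := by exact_mod_cast (by omega : 0 < c)
  rw [div_lt_div_iff₀ (by positivity) (by positivity)] at h
  have h' : 2 ^ m < (2 * q + 2) * (2 * q + 2) * (4 * c) := by
    have : ((2 ^ m : ℕ) : ℝ) < (((2 * q + 2) * (2 * q + 2) * (4 * c) : ℕ) : ℝ) := by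
      push_cast at h ⊢
      linarith
    exact_mod_cast this
  have hqn : 2 * q + 2 ≤ n := by
    have : (2 * q + 2) * 1 ≤ (2 * q + 2) * (2 * d + 1) := Nat.mul_le_mul_left _ (by omega)
    omega
  have h3 : (2 * q + 2) * (2 * q + 2) * (4 * c) * 2 ≤ n * n * n := by
    calc (2 * q + 2) * (2 * q + 2) * (4 * c) * 2 = (2 * q + 2) * (2 * q + 2) * (8 * c) := by ring
      _ ≤ n * n * n := Nat.mul_le_mul (Nat.mul_le_mul hqn hqn) hn
  have h10 : n * n * n ≤ n ^ 10 := by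
    calc n * n * n = n ^ 3 := by ring
      _ ≤ n ^ 10 := Nat.pow_le_pow_right hn0 (by norm_num)
  rw [pow_succ 2 m] at hm'
  omega

end Volume

theorem theorem3 (c : ℕ) (hc : 2 ≤ c) :
    (∀ Δ k : ℕ, ∃ (C : ℕ) (A : Volume.Algorithm (Fin c)),
      ∀ n : ℕ, Volume.ColorsTrees c Δ k n (C * n) A) ∧
    (∃ Δ₀ : ℕ, ∀ Δ ≥ Δ₀, ∀ k ≥ 10, ∃ ε : ℝ, 0 < ε ∧ ∃ n₀ : ℕ, ∀ n ≥ n₀,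
      ∀ (A : Volume.Algorithm (Fin c)) (q : ℕ),
        Volume.ColorsTrees c Δ k n q A → ε * (n : ℝ) ≤ (q : ℝ)) := by
  refine ⟨fun Δ k => Volume.exists_linear_algorithm hc Δ k, 2 * (5 * c) ^ 2, ?_⟩
  intro Δ hΔ k hk
  let D : ℕ := 2 * (5 * c) ^ 2 + 1
  refine ⟨1 / (4 * (D : ℝ)), by positivity, 4 * D + 8 * c, ?_⟩
  intro n hn A q hA
  have h : n < (2 * q + 2) * D := Volume.lt_probes hc hΔ hk (by omega) hA
  have h' : n ≤ 4 * D * q := by nlinarith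
  rw [one_div_mul_eq_div, div_le_iff₀ (by positivity), mul_comm]
  exact_mod_cast h'
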